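/- Let $\mathbb R^3_1$ be the oriented Minkowski space with metric $\langle x,y\rangle=x_1y_1+x_2y_2-x_3y_3$. A *motion* is an orientation-preserving affine isometry of $\mathbb R^3_1$; "smooth" means $C^\infty$. For a smooth map $z=z(u,v)$ put $E=\langle z_u,z_u\rangle$, $F=\langle z_u,z_v\rangle$, $G=\langle z_v,z_v\rangle$. A time-like surface in principal parameters $(u,v)$ on an open set is such a $z$ with $E<0$, $G>0$, $F=0$, $M=0$ and $\nu_1\neq\nu_2$; here $l$ is the unit normal, $\langle l,l\rangle=1$, with $(z_u,z_v,l)$ positively oriented, $L=\langle l,z_{uu}\rangle$, $M=\langle l,z_{uv}\rangle$, $N=\langle l,z_{vv}\rangle$, and $$\nu_1=\frac LE,\qquad \nu_2=\frac NG,\qquad \gamma_1=\frac{E_v}{2E\sqrt G},\qquad \gamma_2=\frac{-G_u}{2G\sqrt{-E}}$$ are the principal curvatures and the principal geodesic curvatures. **Theorem.** Let $f,g$ be smooth functions on an open interval $\mathcal I$ with $f-g\neq0$ and $f'g'\neq0$ on $\mathcal I$. Let $\mathcal D\subseteq\mathbb R^2$ be open, $(u_0,v_0)\in\mathcal D$,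 and let $\nu=\nu(u)$ be a smooth function on the projection of $\mathcal D$ to the $u$-axis with $\nu_u\neq0$ and values in $\mathcal I$. Put $\nu_0=\nu(u_0)$ and $$I(u)=\int_{\nu_0}^{\nu(u)}\frac{f'(s)\,ds}{f(s)-g(s)},\qquad J(u)=\int_{\nu_0}^{\nu(u)}\frac{g'(s)\,ds}{g(s)-f(s)},$$ let $\mathfrak a>0$ be a constant, and suppose that on $\mathcal D$ $$\mathfrak a^2e^{2I}\left(J_{uu}+I_uJ_u-J_u^2\right)=-f(\nu)\,g(\nu).$$ Consider time-like surfaces in principal parameters $(u,v)$ which are W-surfaces with the invariants $$\nu_1=f(\nu),\quad \nu_2=g(\nu),\quad \gamma_1=0,\quad \gamma_2=\mathfrak a\,e^{I}J_u,\qquad(\ast)$$ and call $(u,v)$ *natural* principal parameters on such a surface if $\sqrt{-E}\,e^{I}$ and $\sqrt G\,e^{J}$ are constant. 1. (Existence.) There is a connected open set $\mathcal D_0\subseteq\mathcal D$ containing $(u_0,v_0)$ such that for every $\mathfrak b>0$ there is a time-like W-surface $z(u,v)$, $(u,v)\in\mathcal D_0$, with the invariants $(\ast)$, on which $(u,v)$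 are natural principal parameters and $\mathfrak b^2G(u_0,v_0)=1$. 2. (Uniqueness up to a motion.) Let $z_1,z_2$ be two time-like W-surfaces with the invariants $(\ast)$, on open neighbourhoods $\mathcal D_1,\mathcal D_2\subseteq\mathcal D$ of $(u_0,v_0)$. Then there are a motion $T$, an open neighbourhood $W\subseteq\mathcal D_1$ of $(u_0,v_0)$ and a smooth change of parameter $v\mapsto\varphi(v)$ with $\varphi(v_0)=v_0$, $\varphi'>0$, such that for all $(u,v)\in W$ we have $(u,\varphi(v))\in\mathcal D_2$ and $z_1(u,v)=T\bigl(z_2(u,\varphi(v))\bigr)$. If moreover $(u,v)$ are natural principal parameters on both surfaces, then $\varphi(v)=v_0+k\,(v-v_0)$ for a constant $k>0$ and all $(u,v)\in W$. 3. (Uniqueness in normalized natural parameters.) If $z_1,z_2$ are two such surfaces on the same connected open set $\mathcal D_1\subseteq\mathcal D$ containing $(u_0,v_0)$, if $(u,v)$ are natural principal parameters on both, and if their coefficients $G$ agree at $(u_0,v_0)$, then there is a motion $T$ with $z_1=T\circ z_2$ on $\mathcal D_1$. -/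

import Mathlib

open Set
open scoped ContDiff

noncomputable section

namespace TimelikeW

/-- The underlying vector space of the Minkowski space `ℝ³₁`. -/
abbrev V3 : Type := Fin 3 → ℝ

/-- The flat metric of signature `(2,1)`: `e₁² = e₂² = -e₃² = 1`. -/
def mink (x y : V3) : ℝ := x 0 * y 0 + x 1 * y 1 - x 2 * y 2

/-- The vector product of `ℝ³₁`, characterized by `⟨a × b, c⟩ = det (a, b, c)`. -/
def lcross (a b : V3) : V3 :=
  ![a 1 * b 2 - a 2 * b 1, a 2 * b 0 - a 0 * b 2, -(a 0 * b 1 - a 1 * b 0)]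

/-- A motion of `ℝ³₁`: an orientation preserving affine isometry. -/
def IsMotion (T : V3 → V3) : Prop :=
  ∃ (A : Matrix (Fin 3) (Fin 3) ℝ) (c : V3), A.det = 1 ∧
    (∀ x y, mink (A.mulVec x) (A.mulVec y) = mink x y) ∧ ∀ x, T x = A.mulVec x + c

/-- Partial derivative in the first parameter `u`. -/
def dU {W : Type*} [NormedAddCommGroup W] [NormedSpace ℝ W] (h : ℝ × ℝ → W) (p : ℝ × ℝ) : W :=
  deriv (fun t => h (t, p.2)) p.1

/-- Partial derivative in the second parameter `v`. -/
def dV {W : Type*} [NormedAddCommGroup W] [NormedSpace ℝ W] (h : ℝ × ℝ → W) (p : ℝ × ℝ) : W :=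
  deriv (fun t => h (p.1, t)) p.2

/-! Coefficients of the fundamental forms of a parametrized surface `z = z(u,v)`. -/

def coefE (z : ℝ × ℝ → V3) (p : ℝ × ℝ) : ℝ := mink (dU z p) (dU z p)
def coefF (z : ℝ × ℝ → V3) (p : ℝ × ℝ) : ℝ := mink (dU z p) (dV z p)
def coefG (z : ℝ × ℝ → V3) (p : ℝ × ℝ) : ℝ := mink (dV z p) (dV z p)

/-- The unit normal `l`, `l² = 1`, of a time-like surface (where `E G - F² < 0`), chosen so that
`z_u, z_v, l` is positively oriented. -/
def unitNormal (z : ℝ × ℝ → V3) (p : ℝ × ℝ) : V3 :=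
  (Real.sqrt (coefF z p ^ 2 - coefE z p * coefG z p))⁻¹ • lcross (dU z p) (dV z p)

def coefL (z : ℝ × ℝ → V3) (p : ℝ × ℝ) : ℝ := mink (unitNormal z p) (dU (dU z) p)
def coefM (z : ℝ × ℝ → V3) (p : ℝ × ℝ) : ℝ := mink (unitNormal z p) (dV (dU z) p)
def coefN (z : ℝ × ℝ → V3) (p : ℝ × ℝ) : ℝ := mink (unitNormal z p) (dV (dV z) p)

/-! Principal curvatures and principal geodesic curvatures, in principal parameters. -/

def nu1 (z : ℝ × ℝ → V3) (p : ℝ × ℝ) : ℝ := coefL z p / coefE z p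
def nu2 (z : ℝ × ℝ → V3) (p : ℝ × ℝ) : ℝ := coefN z p / coefG z p
def gamma1 (z : ℝ × ℝ → V3) (p : ℝ × ℝ) : ℝ :=
  dV (coefE z) p / (2 * coefE z p * Real.sqrt (coefG z p))
def gamma2 (z : ℝ × ℝ → V3) (p : ℝ × ℝ) : ℝ :=
  -dU (coefG z) p / (2 * coefG z p * Real.sqrt (-coefE z p))

/-- `z` is a smooth time-like surface with parameter domain `D`, without points where the principal
curvatures coincide, and `(u,v)` are principal parameters on it. -/
structure IsTimelikePrincipal (z : ℝ × ℝ → V3) (D : Set (ℝ × ℝ)) : Prop where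
  smooth : ContDiffOn ℝ ∞ z D
  E_neg : ∀ p ∈ D, coefE z p < 0
  G_pos : ∀ p ∈ D, 0 < coefG z p
  F_zero : ∀ p ∈ D, coefF z p = 0
  M_zero : ∀ p ∈ D, coefM z p = 0
  nu_ne : ∀ p ∈ D, nu1 z p ≠ nu2 z p

/-- `f`, `g` are admissible Weingarten functions on the open interval `S`. -/
structure IsWeingartenPair (f g : ℝ → ℝ) (S : Set ℝ) : Prop where
  isOpen : IsOpen S
  ordConnected : S.OrdConnected
  smooth_f : ContDiffOn ℝ ∞ f S
  smooth_g : ContDiffOn ℝ ∞ g S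
  sub_ne : ∀ s ∈ S, f s - g s ≠ 0
  deriv_ne : ∀ s ∈ S, deriv f s * deriv g s ≠ 0

/-- `z` is a time-like W-surface on `D`, in principal parameters, with Weingarten functions `f`, `g`
and function `w = w(u,v)`: its principal curvatures are `f(w)` and `g(w)`. -/
structure IsTimelikeWSurface (f g : ℝ → ℝ) (S : Set ℝ) (w : ℝ × ℝ → ℝ)
    (z : ℝ × ℝ → V3) (D : Set (ℝ × ℝ)) : Prop where
  principal : IsTimelikePrincipal z D
  pair : IsWeingartenPair f g S
  w_mem : ∀ p ∈ D, w p ∈ S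
  nu1_eq : ∀ p ∈ D, nu1 z p = f (w p)
  nu2_eq : ∀ p ∈ D, nu2 z p = g (w p)

/-- `∫_{s₀}^{s} f' / (f - g)`; the second integral of the theory, `∫_{s₀}^{s} g' / (g - f)`, is
`weinInt g f s₀ s`. -/
def weinInt (f g : ℝ → ℝ) (s₀ s : ℝ) : ℝ := ∫ t in s₀..s, deriv f t / (f t - g t)

/-- The principal parameters `(u,v)` of a W-surface are natural: `√(-E) exp (∫ f' dw / (f - g))` and
`√G exp (∫ g' dw / (g - f))` are constant. (The choice of the base point `s₀` is immaterial.) -/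
def IsNatural (f g : ℝ → ℝ) (w : ℝ × ℝ → ℝ) (s₀ : ℝ) (z : ℝ × ℝ → V3) (D : Set (ℝ × ℝ)) : Prop :=
  (∃ c : ℝ, ∀ p ∈ D, Real.sqrt (-coefE z p) * Real.exp (weinInt f g s₀ (w p)) = c) ∧
  (∃ c : ℝ, ∀ p ∈ D, Real.sqrt (coefG z p) * Real.exp (weinInt g f s₀ (w p)) = c)

/-- The function `I`, as a function of `u`, for `ν = ν(u)` and `ν₀ = ν(u₀)`. -/
def funI (f g ν : ℝ → ℝ) (u₀ : ℝ) (u : ℝ) : ℝ := weinInt f g (ν u₀) (ν u)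

/-- The function `J`, as a function of `u`, for `ν = ν(u)` and `ν₀ = ν(u₀)`. -/
def funJ (f g ν : ℝ → ℝ) (u₀ : ℝ) (u : ℝ) : ℝ := weinInt g f (ν u₀) (ν u)

/-- The natural ODE `a² e^{2I} (J_uu + I_u J_u - J_u²) = -f(ν) g(ν)` at the parameter `u`. -/
def NaturalODE (f g ν : ℝ → ℝ) (u₀ a u : ℝ) : Prop :=
  a ^ 2 * Real.exp (2 * funI f g ν u₀ u) *
      (deriv (deriv (funJ f g ν u₀)) u + deriv (funI f g ν u₀) u * deriv (funJ f g ν u₀) u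
        - deriv (funJ f g ν u₀) u ^ 2)
    = -(f (ν u) * g (ν u))

/-- `z` is a time-like W-surface on `D` with invariants `ν₁ = f(ν)`, `ν₂ = g(ν)`, `γ₁ = 0`,
`γ₂ = a e^I J_u`, where `ν = ν(u)`. -/
structure HasInvariants (f g : ℝ → ℝ) (S : Set ℝ) (ν : ℝ → ℝ) (u₀ a : ℝ)
    (z : ℝ × ℝ → V3) (D : Set (ℝ × ℝ)) : Prop where
  surface : IsTimelikeWSurface f g S (fun p => ν p.1) z D
  gamma1_eq : ∀ p ∈ D, gamma1 z p = 0
  gamma2_eq : ∀ p ∈ D,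
    gamma2 z p = a * Real.exp (funI f g ν u₀ p.1) * deriv (funJ f g ν u₀) p.1

end TimelikeW

end

open TimelikeW

open TimelikeW

/-! ### Algebra of the Minkowski space -/

/-! To a surface in principal parameters belongs the orthonormal frame X = z_u/√(-E), Y = z_v/√G, l.
Both halves of the theorem are statements about its structure equations.

Uniqueness. γ₁ = 0 makes E independent of v. The Codazzi equation gives (√G)_u = -J_u √G, hence γ₂ =
J_u/√(-E); comparison with the prescribed γ₂ forces √(-E) = e^{-I}/a, because J_u ≠ 0. The
coefficients of the frame equations are then known functions of u up to the factor √G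
(`HasInvariants.movingFrame`), and near the base point √G = e^{-J} c(v). A change of v absorbs c
(`exists_reparametrization`); in natural parameters c is constant. Once the factors √G agree, the
two frames satisfy the same linear system with Minkowski-antisymmetric coefficients, so the linear
map between them is constant and the surfaces differ by a motion (`MovingFrame.rigidity`).

Existence. Put √G = e^{-J}/b, k = -J_u/√(-E), m = f√(-E), α = k√G, β = g√G. Compatibility of the
frame equations reads α' = mβ, β' = mα. The first is the Gauss equation, which is exactly the
natural ODE; the second is Codazzi, true by the definition of J. So (α, β) is a hyperbolic rotation,
by the angle ∫m, of a constant vector, μ = α² - β² is constant, and Y_vv = μY. Hence frame and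
surface can be written down explicitly (`exists_movingFrame_of_hyperbolic`), and
`MovingFrame.invariants` reads off their invariants. -/

theorem mink_comm (x y : V3) : mink x y = mink y x := by simp only [mink]; ring

theorem mink_add_right (x y z : V3) : mink x (y + z) = mink x y + mink x z := by
  simp only [mink, Pi.add_apply]; ring

theorem mink_add_left (x y z : V3) : mink (x + y) z = mink x z + mink y z := by
  simp only [mink, Pi.add_apply]; ring

theorem mink_smul_right (c : ℝ) (x y : V3) : mink x (c • y) = c * mink x y := by
  simp only [mink, Pi.smul_apply, smul_eq_mul]; ring

theorem mink_smul_left (c : ℝ) (x y : V3) : mink (c • x) y = c * mink x y := by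
  simp only [mink, Pi.smul_apply, smul_eq_mul]; ring

theorem lcross_smul_smul (c d : ℝ) (x y : V3) : lcross (c • x) (d • y) = (c * d) • lcross x y := by
  ext i
  fin_cases i <;> simp [lcross] <;> ring

theorem mink_lcross_left (x y : V3) : mink x (lcross x y) = 0 := by
  simp [mink, lcross]; ring

theorem mink_lcross_right (x y : V3) : mink y (lcross x y) = 0 := by
  simp [mink, lcross]; ring

theorem mink_lcross_self (x y : V3) :
    mink (lcross x y) (lcross x y) = mink x y ^ 2 - mink x x * mink y y := by
  simp [mink, lcross]; ring

/-- `(X, Y, l)` is a positively oriented orthonormal frame of `ℝ³₁` whose first vector is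
time-like. -/
structure IsOrthoFrame (X Y l : V3) : Prop where
  XX : mink X X = -1
  YY : mink Y Y = 1
  XY : mink X Y = 0
  cross : lcross X Y = l

namespace IsOrthoFrame

variable {X Y l : V3}

theorem ll (h : IsOrthoFrame X Y l) : mink l l = 1 := by
  rw [← h.cross, mink_lcross_self, h.XX, h.YY, h.XY]; norm_num

theorem Xl (h : IsOrthoFrame X Y l) : mink X l = 0 := by
  rw [← h.cross, mink_lcross_left]

theorem Yl (h : IsOrthoFrame X Y l) : mink Y l = 0 := by
  rw [← h.cross, mink_lcross_right]

/-- The matrix of an orthonormal frame is invertible, its inverse being the Minkowski adjoint. -/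
theorem dual (h : IsOrthoFrame X Y l) :
    !![X 0, Y 0, l 0; X 1, Y 1, l 1; X 2, Y 2, l 2] *
      !![-X 0, -X 1, X 2; Y 0, Y 1, -Y 2; l 0, l 1, -l 2] = (1 : Matrix (Fin 3) (Fin 3) ℝ) := by
  have h1 := h.XX
  have h2 := h.YY
  have h3 := h.XY
  have h4 := h.ll
  have h5 := h.Xl
  have h6 := h.Yl
  simp only [mink] at h1 h2 h3 h4 h5 h6
  rw [mul_eq_one_comm]
  ext i j
  fin_cases i <;> fin_cases j <;> simp [Matrix.mul_apply, Fin.sum_univ_three] <;> linarith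

/-- Expansion of a vector in an orthonormal frame. -/
theorem expand (h : IsOrthoFrame X Y l) (a : V3) :
    a = (-mink a X) • X + mink a Y • Y + mink a l • l := by
  have hd := congrArg (fun A => A.mulVec a) h.dual
  simp only [Matrix.one_mulVec, ← Matrix.mulVec_mulVec] at hd
  conv_lhs => rw [← hd]
  ext i
  fin_cases i <;>
    simp [Matrix.mulVec, dotProduct, Fin.sum_univ_three, mink] <;> ring

/-- The determinant of the frame is ⟨X × Y, l⟩ = ⟨l, l⟩. -/
theorem det_eq (h : IsOrthoFrame X Y l) :
    Matrix.det !![X 0, Y 0, l 0; X 1, Y 1, l 1; X 2, Y 2, l 2] = 1 := by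
  rw [← h.ll]
  conv_rhs => rw [← h.cross]
  rw [Matrix.det_fin_three]
  simp [mink, lcross]
  rw [← h.cross]
  simp [lcross]
  ring

end IsOrthoFrame

/-- The linear map carrying an orthonormal frame `(X₂, Y₂, l₂)` to another one. -/
def frameMap (X₁ Y₁ l₁ X₂ Y₂ l₂ : V3) : Matrix (Fin 3) (Fin 3) ℝ :=
  !![X₁ 0, Y₁ 0, l₁ 0; X₁ 1, Y₁ 1, l₁ 1; X₁ 2, Y₁ 2, l₁ 2] *
    !![-X₂ 0, -X₂ 1, X₂ 2; Y₂ 0, Y₂ 1, -Y₂ 2; l₂ 0, l₂ 1, -l₂ 2]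

theorem frameMap_mulVec (X₁ Y₁ l₁ X₂ Y₂ l₂ x : V3) :
    (frameMap X₁ Y₁ l₁ X₂ Y₂ l₂).mulVec x
      = (-mink x X₂) • X₁ + mink x Y₂ • Y₁ + mink x l₂ • l₁ := by
  rw [frameMap, ← Matrix.mulVec_mulVec]
  ext i
  fin_cases i <;>
    simp [Matrix.mulVec, dotProduct, Fin.sum_univ_three, mink] <;> ring

/-- The matrix is a product of a frame matrix and the inverse of another, both of determinant 1; it
preserves the metric since both frames have the same Gram matrix. -/
theorem frameMap_isMotion {X₁ Y₁ l₁ X₂ Y₂ l₂ : V3} (h₁ : IsOrthoFrame X₁ Y₁ l₁)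
    (h₂ : IsOrthoFrame X₂ Y₂ l₂) (c : V3) :
    IsMotion fun x => (frameMap X₁ Y₁ l₁ X₂ Y₂ l₂).mulVec x + c := by
  refine ⟨_, c, ?_, fun x y => ?_, fun x => rfl⟩
  · have h := congrArg Matrix.det h₂.dual
    rw [Matrix.det_mul, h₂.det_eq, one_mul, Matrix.det_one] at h
    rw [frameMap, Matrix.det_mul, h₁.det_eq, h, one_mul]
  · conv_rhs => rw [h₂.expand x, h₂.expand y]
    simp only [frameMap_mulVec, mink_add_left, mink_add_right, mink_smul_left, mink_smul_right,
      h₁.XX, h₁.YY, h₁.XY, h₁.ll, h₁.Xl, h₁.Yl, h₂.XX, h₂.YY, h₂.XY, h₂.ll, h₂.Xl, h₂.Yl,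
      mink_comm Y₁ X₁, mink_comm l₁ X₁, mink_comm l₁ Y₁,
      mink_comm Y₂ X₂, mink_comm l₂ X₂, mink_comm l₂ Y₂]

/-! ### Moving frames -/

/-- The linear map on `ℝ × ℝ` with partial derivatives `x` and `y`. -/
noncomputable def grad {W : Type*} [NormedAddCommGroup W] [NormedSpace ℝ W] (x y : W) :
    ℝ × ℝ →L[ℝ] W :=
  (ContinuousLinearMap.fst ℝ ℝ ℝ).smulRight x + (ContinuousLinearMap.snd ℝ ℝ ℝ).smulRight y

theorem grad_apply {W : Type*} [NormedAddCommGroup W] [NormedSpace ℝ W] (x y : W) (p : ℝ × ℝ) :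
    grad x y p = p.1 • x + p.2 • y := by
  simp [grad]

/-- `z` is a surface on `W` with orthonormal frame field `(X, Y, l)`, the coefficients of whose
structure equations are, up to the factor `Q`, functions of `u`. -/
structure MovingFrame (P m k n : ℝ → ℝ) (Q : ℝ × ℝ → ℝ) (z X Y l : ℝ × ℝ → V3)
    (W : Set (ℝ × ℝ)) : Prop where
  ortho : ∀ p ∈ W, IsOrthoFrame (X p) (Y p) (l p)
  dz : ∀ p ∈ W, HasFDerivAt z (grad (P p.1 • X p) (Q p • Y p)) p
  dX : ∀ p ∈ W, HasFDerivAt X (grad (-m p.1 • l p) ((k p.1 * Q p) • Y p)) p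
  dY : ∀ p ∈ W, HasFDerivAt Y (grad 0 ((k p.1 * Q p) • X p + (n p.1 * Q p) • l p)) p
  dl : ∀ p ∈ W, HasFDerivAt l (grad (-m p.1 • X p) (-(n p.1 * Q p) • Y p)) p

theorem MovingFrame.mono {P m k n : ℝ → ℝ} {Q : ℝ × ℝ → ℝ} {z X Y l : ℝ × ℝ → V3}
    {V W : Set (ℝ × ℝ)} (h : MovingFrame P m k n Q z X Y l V) (hW : W ⊆ V) :
    MovingFrame P m k n Q z X Y l W :=
  ⟨fun p hp => h.ortho p (hW hp), fun p hp => h.dz p (hW hp), fun p hp => h.dX p (hW hp),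
    fun p hp => h.dY p (hW hp), fun p hp => h.dl p (hW hp)⟩

/-- The pullback of a moving frame by a change of the parameter `v`. -/
theorem MovingFrame.comp_snd {P m k n : ℝ → ℝ} {Q Q' : ℝ × ℝ → ℝ} {z X Y l : ℝ × ℝ → V3}
    {V W : Set (ℝ × ℝ)} (h : MovingFrame P m k n Q z X Y l V) {φ φ' : ℝ → ℝ}
    (hφ : ∀ p ∈ W, HasDerivAt φ (φ' p.2) p.2) (hV : ∀ p ∈ W, (p.1, φ p.2) ∈ V)
    (hQ : ∀ p ∈ W, Q' p = Q (p.1, φ p.2) * φ' p.2) :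
    MovingFrame P m k n Q' (fun p => z (p.1, φ p.2)) (fun p => X (p.1, φ p.2))
      (fun p => Y (p.1, φ p.2)) (fun p => l (p.1, φ p.2)) W := by
  have key : ∀ (w : ℝ × ℝ → V3) (x y y' : V3), ∀ p ∈ W,
      HasFDerivAt w (grad x y) (p.1, φ p.2) → y' = φ' p.2 • y →
      HasFDerivAt (fun p : ℝ × ℝ => w (p.1, φ p.2)) (grad x y') p := by
    intro w x y y' p hp hw hy
    have h2 : HasFDerivAt (fun p : ℝ × ℝ => φ p.2)
        ((ContinuousLinearMap.snd ℝ ℝ ℝ).smulRight (φ' p.2)) p := by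
      have := (hφ p hp).hasFDerivAt.comp p hasFDerivAt_snd
      refine this.congr_fderiv ?_
      ext <;> simp
    have h3 : HasFDerivAt (fun p : ℝ × ℝ => (p.1, φ p.2)) _ p := hasFDerivAt_fst.prodMk h2
    refine (hw.comp p h3).congr_fderiv ?_
    subst hy
    ext <;> simp [grad_apply]
  refine ⟨fun p hp => h.ortho _ (hV p hp), fun p hp => ?_, fun p hp => ?_, fun p hp => ?_,
    fun p hp => ?_⟩
  · refine key z _ _ _ p hp (h.dz _ (hV p hp)) ?_
    rw [hQ p hp, smul_smul, mul_comm]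
  · refine key X _ _ _ p hp (h.dX _ (hV p hp)) ?_
    rw [hQ p hp, smul_smul]; ring_nf
  · refine key Y _ _ _ p hp (h.dY _ (hV p hp)) ?_
    rw [hQ p hp, smul_add, smul_smul, smul_smul]; ring_nf
  · refine key l _ _ _ p hp (h.dl _ (hV p hp)) ?_
    rw [hQ p hp, smul_smul]; ring_nf

theorem HasFDerivAt.grad_coord {w : ℝ × ℝ → V3} {x y : V3} {p : ℝ × ℝ}
    (h : HasFDerivAt w (grad x y) p) (i : Fin 3) :
    HasFDerivAt (fun p => w p i) (grad (x i) (y i)) p := by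
  refine (hasFDerivAt_pi'.1 h i).congr_fderiv ?_
  ext <;> simp [grad_apply]

/-- Two surfaces with moving frames satisfying the same structure equations on a connected open set
differ by a motion. -/
theorem MovingFrame.rigidity {P m k n : ℝ → ℝ} {Q : ℝ × ℝ → ℝ} {z₁ X₁ Y₁ l₁ z₂ X₂ Y₂ l₂ : ℝ × ℝ → V3}
    {W : Set (ℝ × ℝ)} (h₁ : MovingFrame P m k n Q z₁ X₁ Y₁ l₁ W)
    (h₂ : MovingFrame P m k n Q z₂ X₂ Y₂ l₂ W) (hW : IsOpen W) (hWc : IsPreconnected W)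
    {q : ℝ × ℝ} (hq : q ∈ W) :
    ∃ T : V3 → V3, IsMotion T ∧ ∀ p ∈ W, z₁ p = T (z₂ p) := by
  have hconst : ∀ w : ℝ × ℝ → ℝ, (∀ p ∈ W, HasFDerivAt w (0 : ℝ × ℝ →L[ℝ] ℝ) p) →
      ∀ p ∈ W, w p = w q := fun w hw p hp =>
    hW.is_const_of_fderiv_eq_zero (𝕜 := ℝ) hWc
      (fun x hx => (hw x hx).differentiableAt.differentiableWithinAt)
      (fun x hx => (hw x hx).fderiv) hp hq
  -- Up to signs of columns these are the entries of the map carrying the second frame to the first.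
  -- Their differentials vanish because the common connection matrix is antisymmetric for the
  -- Minkowski metric.
  have hB : ∀ p ∈ W, ∀ i j : Fin 3, X₁ p i * X₂ p j - Y₁ p i * Y₂ p j - l₁ p i * l₂ p j =
      X₁ q i * X₂ q j - Y₁ q i * Y₂ q j - l₁ q i * l₂ q j := by
    intro p hp i j
    refine hconst (fun p => X₁ p i * X₂ p j - Y₁ p i * Y₂ p j - l₁ p i * l₂ p j) ?_ p hp
    intro p hp
    have hX := ((h₁.dX p hp).grad_coord i).mul ((h₂.dX p hp).grad_coord j)
    have hY := ((h₁.dY p hp).grad_coord i).mul ((h₂.dY p hp).grad_coord j)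
    have hl := ((h₁.dl p hp).grad_coord i).mul ((h₂.dl p hp).grad_coord j)
    refine ((hX.sub hY).sub hl).congr_fderiv ?_
    ext <;> simp [grad_apply] <;> ring
  set A := frameMap (X₁ q) (Y₁ q) (l₁ q) (X₂ q) (Y₂ q) (l₂ q) with hA
  have hAp : ∀ p ∈ W, A = frameMap (X₁ p) (Y₁ p) (l₁ p) (X₂ p) (Y₂ p) (l₂ p) := by
    intro p hp
    have hb := hB p hp
    ext i j
    have := hb i j
    rw [hA]
    fin_cases i <;> fin_cases j <;>
      simp [frameMap, Matrix.mul_apply, Fin.sum_univ_three] at this ⊢ <;> linarith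
  have hAX : ∀ p ∈ W, A.mulVec (X₂ p) = X₁ p := by
    intro p hp
    have ho := h₂.ortho p hp
    rw [hAp p hp, frameMap_mulVec, ho.XX, ho.XY, ho.Xl]
    simp
  have hAY : ∀ p ∈ W, A.mulVec (Y₂ p) = Y₁ p := by
    intro p hp
    have ho := h₂.ortho p hp
    rw [hAp p hp, frameMap_mulVec, mink_comm, ho.YY, ho.XY, ho.Yl]
    simp
  refine ⟨_, frameMap_isMotion (h₁.ortho q hq) (h₂.ortho q hq) (z₁ q - A.mulVec (z₂ q)),
    fun p hp => ?_⟩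
  rw [← hA]
  ext i
  -- As A carries X₂, Y₂ to X₁, Y₁ at every point, z₁ and A z₂ have the same differential.
  have := hconst (fun p => z₁ p i - ∑ j, A i j * z₂ p j) (fun p hp => by
    have hz := (h₁.dz p hp).grad_coord i
    have hs : HasFDerivAt (fun p => ∑ j, A i j * z₂ p j) _ p :=
      HasFDerivAt.fun_sum fun j _ => ((h₂.dz p hp).grad_coord j).const_mul (A i j)
    refine (hz.sub hs).congr_fderiv ?_
    have hX := congrFun (hAX p hp) i
    have hY := congrFun (hAY p hp) i
    simp only [Matrix.mulVec, dotProduct, Fin.sum_univ_three] at hX hY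
    ext
    · simp [grad_apply, Fin.sum_univ_three]
      rw [← hX]; ring
    · simp [grad_apply, Fin.sum_univ_three]
      rw [← hY]; ring) p hp
  simp only [Matrix.mulVec, dotProduct, Pi.add_apply, Pi.sub_apply]
  linarith

/-! ### Primitives -/

/-- Order connectedness keeps the whole path of integration inside the open set where the integrand
is continuous. -/
theorem hasDerivAt_integral_of_ordConnected {φ : ℝ → ℝ} {S : Set ℝ} (hS : IsOpen S)
    (hc : S.OrdConnected) (hφ : ContinuousOn φ S) {s₀ s : ℝ} (h₀ : s₀ ∈ S) (hs : s ∈ S) :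
    HasDerivAt (fun s => ∫ t in s₀..s, φ t) (φ s) s :=
  intervalIntegral.integral_hasDerivAt_right
    ((hφ.mono (hc.uIcc_subset h₀ hs)).intervalIntegrable)
    (hφ.stronglyMeasurableAtFilter hS s hs) (hφ.continuousAt (hS.mem_nhds hs))

theorem contDiffOn_of_hasDerivAt {φ Φ : ℝ → ℝ} {S : Set ℝ} (hS : IsOpen S)
    (hφ : ContDiffOn ℝ ∞ φ S) (h : ∀ s ∈ S, HasDerivAt Φ (φ s) s) : ContDiffOn ℝ ∞ Φ S :=
  (contDiffOn_infty_iff_deriv_of_isOpen hS).2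
    ⟨fun s hs => (h s hs).differentiableAt.differentiableWithinAt,
      hφ.congr fun s hs => (h s hs).deriv⟩

theorem contDiffOn_integral_of_ordConnected {φ : ℝ → ℝ} {S : Set ℝ} (hS : IsOpen S)
    (hc : S.OrdConnected) (hφ : ContDiffOn ℝ ∞ φ S) {s₀ : ℝ} (h₀ : s₀ ∈ S) :
    ContDiffOn ℝ ∞ (fun s => ∫ t in s₀..s, φ t) S :=
  contDiffOn_of_hasDerivAt hS hφ fun _ hs =>
    hasDerivAt_integral_of_ordConnected hS hc hφ.continuousOn h₀ hs

theorem ContDiffOn.hasDerivAt_of_isOpen {φ : ℝ → ℝ} {S : Set ℝ} (hφ : ContDiffOn ℝ ∞ φ S)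
    (hS : IsOpen S) {s : ℝ} (hs : s ∈ S) : HasDerivAt φ (deriv φ s) s :=
  ((hφ.contDiffAt (hS.mem_nhds hs)).differentiableAt (by simp)).hasDerivAt

namespace TimelikeW.IsWeingartenPair

variable {f g : ℝ → ℝ} {S : Set ℝ}

theorem swap (h : IsWeingartenPair f g S) : IsWeingartenPair g f S :=
  ⟨h.isOpen, h.ordConnected, h.smooth_g, h.smooth_f,
    fun s hs he => h.sub_ne s hs (by linarith), fun s hs => by
      rw [mul_comm]; exact h.deriv_ne s hs⟩

theorem contDiffOn_integrand (h : IsWeingartenPair f g S) :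
    ContDiffOn ℝ ∞ (fun t => deriv f t / (f t - g t)) S :=
  ((contDiffOn_infty_iff_deriv_of_isOpen h.isOpen).1 h.smooth_f).2.div
    (h.smooth_f.sub h.smooth_g) h.sub_ne

theorem contDiffOn_weinInt (h : IsWeingartenPair f g S) {s₀ : ℝ} (h₀ : s₀ ∈ S) :
    ContDiffOn ℝ ∞ (weinInt f g s₀) S :=
  contDiffOn_integral_of_ordConnected h.isOpen h.ordConnected h.contDiffOn_integrand h₀

theorem contDiffOn_funI (h : IsWeingartenPair f g S) {ν : ℝ → ℝ} {U : Set ℝ}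
    (hν : ContDiffOn ℝ ∞ ν U) (hS : MapsTo ν U S) {u₀ : ℝ} (h₀ : u₀ ∈ U) :
    ContDiffOn ℝ ∞ (funI f g ν u₀) U :=
  (h.contDiffOn_weinInt (hS h₀)).comp hν hS

theorem hasDerivAt_funI (h : IsWeingartenPair f g S) {ν : ℝ → ℝ} {U : Set ℝ} (hU : IsOpen U)
    (hν : ContDiffOn ℝ ∞ ν U) (hS : MapsTo ν U S) {u₀ u : ℝ} (h₀ : u₀ ∈ U) (hu : u ∈ U) :
    HasDerivAt (funI f g ν u₀) (deriv f (ν u) / (f (ν u) - g (ν u)) * deriv ν u) u :=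
  (hasDerivAt_integral_of_ordConnected h.isOpen h.ordConnected
    h.contDiffOn_integrand.continuousOn (hS h₀) (hS hu)).comp u (hν.hasDerivAt_of_isOpen hU hu)

end TimelikeW.IsWeingartenPair

/-- Exchanging f and g turns I into J, so each fact about I yields one about J through `swap`. -/
theorem funI_swap (f g ν : ℝ → ℝ) (u₀ : ℝ) : funI g f ν u₀ = funJ f g ν u₀ := rfl

/-! ### Partial derivatives -/

section Partial

variable {W : Type*} [NormedAddCommGroup W] [NormedSpace ℝ W]

theorem HasFDerivAt.dU_eq {h : ℝ × ℝ → W} {x y : W} {p : ℝ × ℝ}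
    (hh : HasFDerivAt h (grad x y) p) : dU h p = x := by
  have hl : HasDerivAt (fun t : ℝ => (t, p.2)) ((1 : ℝ), (0 : ℝ)) p.1 :=
    (hasDerivAt_id _).prodMk (hasDerivAt_const _ _)
  have h1 : dU h p = _ :=
    (HasFDerivAt.comp_hasDerivAt (l := h) (l' := grad x y) p.1 hh hl).deriv
  rw [h1]
  simp [grad_apply]

theorem HasFDerivAt.dV_eq {h : ℝ × ℝ → W} {x y : W} {p : ℝ × ℝ}
    (hh : HasFDerivAt h (grad x y) p) : dV h p = y := by
  have hl : HasDerivAt (fun t : ℝ => (p.1, t)) ((0 : ℝ), (1 : ℝ)) p.2 :=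
    (hasDerivAt_const _ _).prodMk (hasDerivAt_id _)
  have h1 : dV h p = _ :=
    (HasFDerivAt.comp_hasDerivAt (l := h) (l' := grad x y) p.2 hh hl).deriv
  rw [h1]
  simp [grad_apply]

theorem fderiv_eq_grad (L : ℝ × ℝ →L[ℝ] W) : L = grad (L (1, 0)) (L (0, 1)) := by
  ext <;> simp [grad_apply]

theorem DifferentiableAt.hasFDerivAt_grad {h : ℝ × ℝ → W} {p : ℝ × ℝ}
    (hh : DifferentiableAt ℝ h p) : HasFDerivAt h (grad (dU h p) (dV h p)) p := by
  have h1 := hh.hasFDerivAt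
  rw [fderiv_eq_grad (fderiv ℝ h p)] at h1
  rwa [h1.dU_eq, h1.dV_eq]

variable {h h' : ℝ × ℝ → W} {D : Set (ℝ × ℝ)}

theorem dU_eq_fderiv {p : ℝ × ℝ} (hh : DifferentiableAt ℝ h p) : dU h p = fderiv ℝ h p (1, 0) := by
  rw [hh.hasFDerivAt_grad.fderiv]; simp [grad_apply]

theorem dV_eq_fderiv {p : ℝ × ℝ} (hh : DifferentiableAt ℝ h p) : dV h p = fderiv ℝ h p (0, 1) := by
  rw [hh.hasFDerivAt_grad.fderiv]; simp [grad_apply]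

theorem ContDiffOn.differentiableAt_of_isOpen (hh : ContDiffOn ℝ ∞ h D) (hD : IsOpen D)
    {p : ℝ × ℝ} (hp : p ∈ D) : DifferentiableAt ℝ h p :=
  (hh.contDiffAt (hD.mem_nhds hp)).differentiableAt (by simp)

theorem ContDiffOn.hasFDerivAt_grad (hh : ContDiffOn ℝ ∞ h D) (hD : IsOpen D)
    {p : ℝ × ℝ} (hp : p ∈ D) : HasFDerivAt h (grad (dU h p) (dV h p)) p :=
  (hh.differentiableAt_of_isOpen hD hp).hasFDerivAt_grad

theorem contDiffOn_dU (hh : ContDiffOn ℝ ∞ h D) (hD : IsOpen D) : ContDiffOn ℝ ∞ (dU h) D :=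
  ((hh.fderiv_of_isOpen hD (m := ∞) (by simp)).clm_apply contDiffOn_const).congr fun _ hp =>
    dU_eq_fderiv (hh.differentiableAt_of_isOpen hD hp)

theorem contDiffOn_dV (hh : ContDiffOn ℝ ∞ h D) (hD : IsOpen D) : ContDiffOn ℝ ∞ (dV h) D :=
  ((hh.fderiv_of_isOpen hD (m := ∞) (by simp)).clm_apply contDiffOn_const).congr fun _ hp =>
    dV_eq_fderiv (hh.differentiableAt_of_isOpen hD hp)

theorem HasFDerivAt.congr_of_eqOn {L : ℝ × ℝ →L[ℝ] W} {p : ℝ × ℝ} (hh : HasFDerivAt h L p)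
    (hD : IsOpen D) (he : EqOn h' h D) (hp : p ∈ D) : HasFDerivAt h' L p :=
  hh.congr_of_eventuallyEq (he.eventuallyEq_of_mem (hD.mem_nhds hp))

/-- Schwarz's theorem. Applied to z it supplies the mixed terms of the structure equations, and
applied to l the Codazzi equation. -/
theorem dV_dU_comm (hh : ContDiffOn ℝ ∞ h D) (hD : IsOpen D) {p : ℝ × ℝ} (hp : p ∈ D) :
    dV (dU h) p = dU (dV h) p := by
  have hd := ((hh.fderiv_of_isOpen hD (m := ∞) (by simp)).differentiableAt_of_isOpen hD
    hp).hasFDerivAt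
  have hsym := second_derivative_symmetric_of_eventually (f := h) (f' := fderiv ℝ h) (x := p)
    (Filter.eventually_of_mem (hD.mem_nhds hp) fun q hq =>
      (hh.differentiableAt_of_isOpen hD hq).hasFDerivAt) hd (1, 0) (0, 1)
  have h1 : HasFDerivAt (fun q => fderiv ℝ h q (1, 0)) _ p := hd.clm_apply (hasFDerivAt_const _ p)
  have h2 : HasFDerivAt (fun q => fderiv ℝ h q (0, 1)) _ p := hd.clm_apply (hasFDerivAt_const _ p)
  have h1' := h1.congr_of_eqOn hD
    (fun q hq => dU_eq_fderiv (hh.differentiableAt_of_isOpen hD hq)) hp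
  have h2' := h2.congr_of_eqOn hD
    (fun q hq => dV_eq_fderiv (hh.differentiableAt_of_isOpen hD hq)) hp
  rw [dV_eq_fderiv h1'.differentiableAt, dU_eq_fderiv h2'.differentiableAt, h1'.fderiv, h2'.fderiv]
  simpa using hsym.symm

theorem HasFDerivAt.smul_grad {r : ℝ × ℝ → ℝ} {a b : ℝ} {x y : W} {p : ℝ × ℝ}
    (hr : HasFDerivAt r (grad a b) p) (hh : HasFDerivAt h (grad x y) p) :
    HasFDerivAt (fun q => r q • h q) (grad (a • h p + r p • x) (b • h p + r p • y)) p := by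
  refine (hr.smul hh).congr_fderiv ?_
  ext <;> simp [grad_apply, add_comm]

end Partial

theorem HasDerivAt.fst_grad {φ : ℝ → ℝ} {φ' : ℝ} {p : ℝ × ℝ} (h : HasDerivAt φ φ' p.1) :
    HasFDerivAt (fun q : ℝ × ℝ => φ q.1) (grad φ' 0) p := by
  refine (h.hasFDerivAt.comp p hasFDerivAt_fst).congr_fderiv ?_
  ext <;> simp [grad_apply]

theorem HasDerivAt.snd_grad {φ : ℝ → ℝ} {φ' : ℝ} {p : ℝ × ℝ} (h : HasDerivAt φ φ' p.2) :
    HasFDerivAt (fun q : ℝ × ℝ => φ q.2) (grad 0 φ') p := by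
  refine (h.hasFDerivAt.comp p hasFDerivAt_snd).congr_fderiv ?_
  ext <;> simp [grad_apply]

theorem HasFDerivAt.mink_grad {x y : ℝ × ℝ → V3} {a b c d : V3} {p : ℝ × ℝ}
    (hx : HasFDerivAt x (grad a b) p) (hy : HasFDerivAt y (grad c d) p) :
    HasFDerivAt (fun q => mink (x q) (y q))
      (grad (mink a (y p) + mink (x p) c) (mink b (y p) + mink (x p) d)) p := by
  refine (((hx.grad_coord 0).mul (hy.grad_coord 0)).add
    ((hx.grad_coord 1).mul (hy.grad_coord 1))).sub
    ((hx.grad_coord 2).mul (hy.grad_coord 2)) |>.congr_fderiv ?_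
  ext <;> simp [grad_apply, mink] <;> ring

theorem ContDiffOn.mink {x y : ℝ × ℝ → V3} {D : Set (ℝ × ℝ)} (hx : ContDiffOn ℝ ∞ x D)
    (hy : ContDiffOn ℝ ∞ y D) : ContDiffOn ℝ ∞ (fun q => mink (x q) (y q)) D := by
  have hx := contDiffOn_pi.1 hx
  have hy := contDiffOn_pi.1 hy
  exact (((hx 0).mul (hy 0)).add ((hx 1).mul (hy 1))).sub ((hx 2).mul (hy 2))

theorem ContDiffOn.lcross {x y : ℝ × ℝ → V3} {D : Set (ℝ × ℝ)} (hx : ContDiffOn ℝ ∞ x D)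
    (hy : ContDiffOn ℝ ∞ y D) : ContDiffOn ℝ ∞ (fun q => lcross (x q) (y q)) D := by
  have hx := contDiffOn_pi.1 hx
  have hy := contDiffOn_pi.1 hy
  refine contDiffOn_pi.2 fun i => ?_
  fin_cases i
  · exact ((hx 1).mul (hy 2)).sub ((hx 2).mul (hy 1))
  · exact ((hx 2).mul (hy 0)).sub ((hx 0).mul (hy 2))
  · exact (((hx 0).mul (hy 1)).sub ((hx 1).mul (hy 0))).neg

/-! ### The moving frame of a surface in principal parameters -/

namespace TimelikeW

/-- The factor `√(-E)`. -/
noncomputable def sqrtE (z : ℝ × ℝ → V3) (p : ℝ × ℝ) : ℝ := Real.sqrt (-coefE z p)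

/-- The factor `√G`. -/
noncomputable def sqrtG (z : ℝ × ℝ → V3) (p : ℝ × ℝ) : ℝ := Real.sqrt (coefG z p)

/-- The unit vector in the first principal direction. -/
noncomputable def unitU (z : ℝ × ℝ → V3) (p : ℝ × ℝ) : V3 := (sqrtE z p)⁻¹ • dU z p

/-- The unit vector in the second principal direction. -/
noncomputable def unitV (z : ℝ × ℝ → V3) (p : ℝ × ℝ) : V3 := (sqrtG z p)⁻¹ • dV z p

namespace IsTimelikePrincipal

variable {z : ℝ × ℝ → V3} {D : Set (ℝ × ℝ)}

theorem sqrtE_pos (h : IsTimelikePrincipal z D) {p : ℝ × ℝ} (hp : p ∈ D) : 0 < sqrtE z p :=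
  Real.sqrt_pos.2 (neg_pos.2 (h.E_neg p hp))

theorem sqrtG_pos (h : IsTimelikePrincipal z D) {p : ℝ × ℝ} (hp : p ∈ D) : 0 < sqrtG z p :=
  Real.sqrt_pos.2 (h.G_pos p hp)

theorem coefE_eq (h : IsTimelikePrincipal z D) {p : ℝ × ℝ} (hp : p ∈ D) :
    coefE z p = -sqrtE z p ^ 2 := by
  rw [sqrtE, Real.sq_sqrt (neg_pos.2 (h.E_neg p hp)).le, neg_neg]

theorem coefG_eq (h : IsTimelikePrincipal z D) {p : ℝ × ℝ} (hp : p ∈ D) :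
    coefG z p = sqrtG z p ^ 2 := by
  rw [sqrtG, Real.sq_sqrt (h.G_pos p hp).le]

theorem dU_eq (h : IsTimelikePrincipal z D) {p : ℝ × ℝ} (hp : p ∈ D) :
    dU z p = sqrtE z p • unitU z p := by
  rw [unitU, smul_inv_smul₀ (h.sqrtE_pos hp).ne']

theorem dV_eq (h : IsTimelikePrincipal z D) {p : ℝ × ℝ} (hp : p ∈ D) :
    dV z p = sqrtG z p • unitV z p := by
  rw [unitV, smul_inv_smul₀ (h.sqrtG_pos hp).ne']

/-- With F = 0 the normalizing factor √(F² - EG) is √(-E) √G, so the unit normal is exactly the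
product of the two unit tangents. -/
theorem orthoFrame (h : IsTimelikePrincipal z D) {p : ℝ × ℝ} (hp : p ∈ D) :
    IsOrthoFrame (unitU z p) (unitV z p) (unitNormal z p) := by
  have hE := (h.sqrtE_pos hp).ne'
  have hG := (h.sqrtG_pos hp).ne'
  refine ⟨?_, ?_, ?_, ?_⟩
  · rw [unitU, mink_smul_left, mink_smul_right]
    change _ * (_ * coefE z p) = _
    rw [h.coefE_eq hp]
    field_simp
  · rw [unitV, mink_smul_left, mink_smul_right]
    change _ * (_ * coefG z p) = _
    rw [h.coefG_eq hp]
    field_simp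
  · rw [unitU, unitV, mink_smul_left, mink_smul_right]
    change _ * (_ * coefF z p) = _
    rw [h.F_zero p hp]
    simp
  · rw [unitU, unitV, lcross_smul_smul, unitNormal, h.F_zero p hp, h.coefE_eq hp, h.coefG_eq hp]
    have : (0 : ℝ) ^ 2 - -sqrtE z p ^ 2 * sqrtG z p ^ 2 = (sqrtE z p * sqrtG z p) ^ 2 := by ring
    rw [this, Real.sqrt_sq (mul_pos (h.sqrtE_pos hp) (h.sqrtG_pos hp)).le, mul_inv]

theorem contDiffOn_sqrtE (h : IsTimelikePrincipal z D) (hD : IsOpen D) :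
    ContDiffOn ℝ ∞ (sqrtE z) D :=
  ((contDiffOn_dU h.smooth hD).mink (contDiffOn_dU h.smooth hD)).neg.sqrt
    fun p hp => (neg_pos.2 (h.E_neg p hp)).ne'

theorem contDiffOn_sqrtG (h : IsTimelikePrincipal z D) (hD : IsOpen D) :
    ContDiffOn ℝ ∞ (sqrtG z) D :=
  ((contDiffOn_dV h.smooth hD).mink (contDiffOn_dV h.smooth hD)).sqrt
    fun p hp => (h.G_pos p hp).ne'

theorem contDiffOn_unitU (h : IsTimelikePrincipal z D) (hD : IsOpen D) :
    ContDiffOn ℝ ∞ (unitU z) D :=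
  ((h.contDiffOn_sqrtE hD).inv fun _ hp => (h.sqrtE_pos hp).ne').smul (contDiffOn_dU h.smooth hD)

theorem contDiffOn_unitV (h : IsTimelikePrincipal z D) (hD : IsOpen D) :
    ContDiffOn ℝ ∞ (unitV z) D :=
  ((h.contDiffOn_sqrtG hD).inv fun _ hp => (h.sqrtG_pos hp).ne').smul (contDiffOn_dV h.smooth hD)

theorem contDiffOn_unitNormal (h : IsTimelikePrincipal z D) (hD : IsOpen D) :
    ContDiffOn ℝ ∞ (unitNormal z) D :=
  ((h.contDiffOn_unitU hD).lcross (h.contDiffOn_unitV hD)).congr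
    fun _ hp => (h.orthoFrame hp).cross.symm

/-- The structure equations of a surface in principal parameters with `E` independent of `v`. -/
theorem structure_eqs (h : IsTimelikePrincipal z D) (hD : IsOpen D)
    (hEv : ∀ p ∈ D, dV (sqrtE z) p = 0) {p : ℝ × ℝ} (hp : p ∈ D) :
    dU (unitU z) p = -(nu1 z p * sqrtE z p) • unitNormal z p ∧
    dV (unitU z) p = (dU (sqrtG z) p / sqrtE z p) • unitV z p ∧
    dU (unitV z) p = 0 ∧
    dV (unitV z) p = (dU (sqrtG z) p / sqrtE z p) • unitU z p
      + (nu2 z p * sqrtG z p) • unitNormal z p ∧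
    dU (unitNormal z) p = -(nu1 z p * sqrtE z p) • unitU z p ∧
    dV (unitNormal z) p = -(nu2 z p * sqrtG z p) • unitV z p := by
  have hE := (h.sqrtE_pos hp).ne'
  have hG := (h.sqrtG_pos hp).ne'
  have hX := (h.contDiffOn_unitU hD).hasFDerivAt_grad hD hp
  have hY := (h.contDiffOn_unitV hD).hasFDerivAt_grad hD hp
  have hl := (h.contDiffOn_unitNormal hD).hasFDerivAt_grad hD hp
  have hsE := (h.contDiffOn_sqrtE hD).hasFDerivAt_grad hD hp
  have hsG := (h.contDiffOn_sqrtG hD).hasFDerivAt_grad hD hp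
  have hzu := (hsE.smul_grad hX).congr_of_eqOn hD (fun q hq => h.dU_eq hq) hp
  have hzv := (hsG.smul_grad hY).congr_of_eqOn hD (fun q hq => h.dV_eq hq) hp
  have hmix := dV_dU_comm h.smooth hD hp
  have hL : mink (unitNormal z p) (dU (dU z) p) = nu1 z p * -sqrtE z p ^ 2 := by
    rw [← h.coefE_eq hp, nu1, div_mul_cancel₀ _ (h.E_neg p hp).ne, coefL]
  have hM : mink (unitNormal z p) (dV (dU z) p) = 0 := h.M_zero p hp
  have hN : mink (unitNormal z p) (dV (dV z) p) = nu2 z p * sqrtG z p ^ 2 := by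
    rw [← h.coefG_eq hp, nu2, div_mul_cancel₀ _ (h.G_pos p hp).ne', coefN]
  rw [hzu.dV_eq] at hM
  rw [hzu.dV_eq, hzv.dU_eq, hEv p hp, zero_smul, zero_add] at hmix
  rw [hEv p hp, zero_smul, zero_add] at hM
  rw [hzu.dU_eq] at hL
  rw [hzv.dV_eq] at hN
  have o := h.orthoFrame hp
  -- Differentiating the six constant products of frame vectors gives the antisymmetry of the
  -- connection coefficients.
  have cst : ∀ (x y : ℝ × ℝ → V3) (a b c d : V3) (r : ℝ), HasFDerivAt x (grad a b) p →
      HasFDerivAt y (grad c d) p → (∀ q ∈ D, mink (x q) (y q) = r) →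
      mink a (y p) + mink (x p) c = 0 ∧ mink b (y p) + mink (x p) d = 0 := by
    intro x y a b c d r hx hy hr
    have h1 := (hasFDerivAt_const r p).congr_of_eqOn hD hr hp
    have h2 := h1.unique (hx.mink_grad hy)
    constructor
    · simpa [grad_apply] using (congrArg (fun L => L (1, 0)) h2).symm
    · simpa [grad_apply] using (congrArg (fun L => L (0, 1)) h2).symm
  obtain ⟨XX1, XX2⟩ := cst _ _ _ _ _ _ _ hX hX fun q hq => (h.orthoFrame hq).XX
  obtain ⟨YY1, YY2⟩ := cst _ _ _ _ _ _ _ hY hY fun q hq => (h.orthoFrame hq).YY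
  obtain ⟨ll1, ll2⟩ := cst _ _ _ _ _ _ _ hl hl fun q hq => (h.orthoFrame hq).ll
  obtain ⟨XY1, XY2⟩ := cst _ _ _ _ _ _ _ hX hY fun q hq => (h.orthoFrame hq).XY
  obtain ⟨Xl1, Xl2⟩ := cst _ _ _ _ _ _ _ hX hl fun q hq => (h.orthoFrame hq).Xl
  obtain ⟨Yl1, Yl2⟩ := cst _ _ _ _ _ _ _ hY hl fun q hq => (h.orthoFrame hq).Yl
  -- The relation z_uv = z_vu, here √(-E) X_v = (√G)_u Y + √G Y_u, is split into its three frame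
  -- components; together with L, M, N these determine the coefficients not fixed by antisymmetry.
  have mX := congrArg (fun a => mink a (unitU z p)) hmix
  have mY := congrArg (fun a => mink a (unitV z p)) hmix
  have ml := congrArg (fun a => mink a (unitNormal z p)) hmix
  set X := unitU z p
  set Y := unitV z p
  set l := unitNormal z p
  set R := sqrtE z p
  set Q := sqrtG z p
  have cYX : mink Y X = 0 := by rw [mink_comm, o.XY]
  simp only [mink_add_left, mink_smul_left, o.YY, o.Xl, o.Yl, cYX, mink_comm X (_ : V3), mink_comm Y (_ : V3),
    mink_comm l (_ : V3)] at XX1 XX2 YY1 YY2 ll1 ll2 XY1 XY2 Xl1 Xl2 Yl1 Yl2 mX mY ml hL hM hN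
  have e1 : mink (dU (unitU z) p) X = 0 := by linarith
  have e2 : mink (dV (unitU z) p) X = 0 := by linarith
  have e3 : mink (dU (unitV z) p) Y = 0 := by linarith
  have e4 : mink (dV (unitV z) p) Y = 0 := by linarith
  have e5 : mink (dU (unitNormal z) p) l = 0 := by linarith
  have e6 : mink (dV (unitNormal z) p) l = 0 := by linarith
  have e7 : mink (dU (unitV z) p) X = 0 := by
    refine (mul_eq_zero.1 (?_ : Q * _ = 0)).resolve_left hG
    rw [e2] at mX; linarith
  have e8 : mink (dV (unitU z) p) Y = dU (sqrtG z) p / R := by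
    rw [eq_div_iff hE]; rw [e3] at mY; linarith
  have e9 : mink (dV (unitU z) p) l = 0 := by
    refine (mul_eq_zero.1 (?_ : R * _ = 0)).resolve_left hE
    linarith
  have e10 : mink (dU (unitV z) p) l = 0 := by
    refine (mul_eq_zero.1 (?_ : Q * _ = 0)).resolve_left hG
    rw [e9] at ml; linarith
  have e11 : mink (dU (unitU z) p) l = -(nu1 z p * R) := by
    apply mul_left_cancel₀ hE; linarith
  have e12 : mink (dV (unitV z) p) l = nu2 z p * Q := by
    apply mul_left_cancel₀ hG; linarith
  refine ⟨?_, ?_, ?_, ?_, ?_, ?_⟩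
  · rw [o.expand (dU (unitU z) p), e1, e11, show mink (dU (unitU z) p) Y = 0 by linarith]
    simp
  · rw [o.expand (dV (unitU z) p), e2, e8, e9]
    simp
  · rw [o.expand (dU (unitV z) p), e7, e3, e10]
    simp
  · rw [o.expand (dV (unitV z) p), e4, e12,
      show mink (dV (unitV z) p) X = -(dU (sqrtG z) p / R) by linarith]
    simp
  · rw [o.expand (dU (unitNormal z) p), e5,
      show mink (dU (unitNormal z) p) X = nu1 z p * R by linarith,
      show mink (dU (unitNormal z) p) Y = 0 by linarith]
    simp
  · rw [o.expand (dV (unitNormal z) p), e6,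
      show mink (dV (unitNormal z) p) X = 0 by linarith,
      show mink (dV (unitNormal z) p) Y = -(nu2 z p * Q) by linarith]
    simp

end IsTimelikePrincipal

end TimelikeW

/-! ### The prescribed invariants determine the structure equations up to √G -/

namespace TimelikeW

/-- The function `√(-E) = e^{-I} / a` of a W-surface with the prescribed invariants. -/
noncomputable def scaleE (f g ν : ℝ → ℝ) (u₀ a u : ℝ) : ℝ := Real.exp (-funI f g ν u₀ u) / a

/-- A smooth function `ν` on an open set, without critical points and with values in the domain of
the Weingarten functions `f`, `g`. -/
structure IsAdmissible (f g : ℝ → ℝ) (S : Set ℝ) (ν : ℝ → ℝ) (u₀ : ℝ) (U : Set ℝ) : Prop where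
  pair : IsWeingartenPair f g S
  isOpen : IsOpen U
  smooth : ContDiffOn ℝ ∞ ν U
  mapsTo : MapsTo ν U S
  deriv_ne : ∀ u ∈ U, deriv ν u ≠ 0
  mem : u₀ ∈ U

namespace IsAdmissible

variable {f g : ℝ → ℝ} {S : Set ℝ} {ν : ℝ → ℝ} {u₀ : ℝ} {U : Set ℝ}

theorem mono (h : IsAdmissible f g S ν u₀ U) {V : Set ℝ} (hV : IsOpen V) (hVU : V ⊆ U)
    (h₀ : u₀ ∈ V) : IsAdmissible f g S ν u₀ V :=
  ⟨h.pair, hV, h.smooth.mono hVU, h.mapsTo.mono_left hVU, fun u hu => h.deriv_ne u (hVU hu), h₀⟩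

theorem swap (h : IsAdmissible f g S ν u₀ U) : IsAdmissible g f S ν u₀ U :=
  ⟨h.pair.swap, h.isOpen, h.smooth, h.mapsTo, h.deriv_ne, h.mem⟩

theorem contDiffOn_f (h : IsAdmissible f g S ν u₀ U) : ContDiffOn ℝ ∞ (fun u => f (ν u)) U :=
  h.pair.smooth_f.comp h.smooth h.mapsTo

theorem hasDerivAt_f (h : IsAdmissible f g S ν u₀ U) {u : ℝ} (hu : u ∈ U) :
    HasDerivAt (fun u => f (ν u)) (deriv f (ν u) * deriv ν u) u :=
  (h.pair.smooth_f.hasDerivAt_of_isOpen h.pair.isOpen (h.mapsTo hu)).comp u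
    (h.smooth.hasDerivAt_of_isOpen h.isOpen hu)

theorem contDiffOn_funI (h : IsAdmissible f g S ν u₀ U) : ContDiffOn ℝ ∞ (funI f g ν u₀) U :=
  h.pair.contDiffOn_funI h.smooth h.mapsTo h.mem

theorem contDiffOn_funJ (h : IsAdmissible f g S ν u₀ U) : ContDiffOn ℝ ∞ (funJ f g ν u₀) U :=
  h.swap.contDiffOn_funI

theorem contDiffOn_deriv_funJ (h : IsAdmissible f g S ν u₀ U) :
    ContDiffOn ℝ ∞ (deriv (funJ f g ν u₀)) U :=
  ((contDiffOn_infty_iff_deriv_of_isOpen h.isOpen).1 h.contDiffOn_funJ).2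

theorem hasDerivAt_funI (h : IsAdmissible f g S ν u₀ U) {u : ℝ} (hu : u ∈ U) :
    HasDerivAt (funI f g ν u₀) (deriv (funI f g ν u₀) u) u :=
  h.contDiffOn_funI.hasDerivAt_of_isOpen h.isOpen hu

theorem hasDerivAt_funJ (h : IsAdmissible f g S ν u₀ U) {u : ℝ} (hu : u ∈ U) :
    HasDerivAt (funJ f g ν u₀) (deriv (funJ f g ν u₀) u) u :=
  h.contDiffOn_funJ.hasDerivAt_of_isOpen h.isOpen hu

theorem deriv_funI (h : IsAdmissible f g S ν u₀ U) {u : ℝ} (hu : u ∈ U) :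
    deriv (funI f g ν u₀) u = deriv f (ν u) / (f (ν u) - g (ν u)) * deriv ν u :=
  (h.pair.hasDerivAt_funI h.isOpen h.smooth h.mapsTo h.mem hu).deriv

theorem sub_ne (h : IsAdmissible f g S ν u₀ U) {u : ℝ} (hu : u ∈ U) : f (ν u) - g (ν u) ≠ 0 :=
  h.pair.sub_ne _ (h.mapsTo hu)

/-- `J_u (g - f) = g' ν_u`. -/
theorem deriv_funJ_mul (h : IsAdmissible f g S ν u₀ U) {u : ℝ} (hu : u ∈ U) :
    deriv (funJ f g ν u₀) u * (g (ν u) - f (ν u)) = deriv g (ν u) * deriv ν u := by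
  have h1 := h.swap.deriv_funI hu
  rw [funI_swap] at h1
  rw [h1]
  have := h.swap.sub_ne hu
  field_simp

/-- Here g' ≠ 0 and ν_u ≠ 0 enter; the factor J_u is later cancelled from γ₂ to recover E. -/
theorem deriv_funJ_ne (h : IsAdmissible f g S ν u₀ U) {u : ℝ} (hu : u ∈ U) :
    deriv (funJ f g ν u₀) u ≠ 0 := by
  intro h0
  have h1 := h.deriv_funJ_mul hu
  rw [h0, zero_mul] at h1
  exact mul_ne_zero (right_ne_zero_of_mul (h.pair.deriv_ne _ (h.mapsTo hu))) (h.deriv_ne u hu)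
    h1.symm

end IsAdmissible

theorem funJ_self (f g ν : ℝ → ℝ) (u₀ : ℝ) : funJ f g ν u₀ u₀ = 0 := by
  simp [funJ, weinInt]

namespace HasInvariants

variable {f g : ℝ → ℝ} {S : Set ℝ} {ν : ℝ → ℝ} {u₀ a : ℝ} {U : Set ℝ} {z : ℝ × ℝ → V3}
  {D : Set (ℝ × ℝ)}

/-- The denominator of γ₁ does not vanish, so γ₁ = 0 means E_v = 0, and E_v = -2 √(-E) (√(-E))_v. -/
theorem dV_sqrtE (h : HasInvariants f g S ν u₀ a z D) (hD : IsOpen D) {p : ℝ × ℝ} (hp : p ∈ D) :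
    dV (sqrtE z) p = 0 := by
  have hP := h.surface.principal
  have h1 := h.gamma1_eq p hp
  have hR := (hP.contDiffOn_sqrtE hD).hasFDerivAt_grad hD hp
  have h2 := (hR.smul_grad hR).neg.congr_of_eqOn hD (h' := coefE z)
    (fun q hq => by rw [hP.coefE_eq hq, sq]; rfl) hp
  have h3 : dV (coefE z) p = -(2 * sqrtE z p * dV (sqrtE z) p) := by
    rw [dV_eq_fderiv h2.differentiableAt, h2.fderiv]
    simp [grad_apply]; ring
  rw [gamma1, div_eq_zero_iff] at h1
  have h4 := h1.resolve_right (mul_ne_zero (mul_ne_zero two_ne_zero (hP.E_neg p hp).ne)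
    (hP.sqrtG_pos hp).ne')
  rw [h3, neg_eq_zero] at h4
  exact (mul_eq_zero.1 h4).resolve_left (mul_ne_zero two_ne_zero (hP.sqrtE_pos hp).ne')

/-- The Codazzi equation: `(√G)_u = -J_u √G`. -/
theorem dU_sqrtG (h : HasInvariants f g S ν u₀ a z D) (hD : IsOpen D)
    (hU : IsAdmissible f g S ν u₀ U) (hDU : ∀ p ∈ D, p.1 ∈ U) {p : ℝ × ℝ} (hp : p ∈ D) :
    dU (sqrtG z) p = -deriv (funJ f g ν u₀) p.1 * sqrtG z p := by
  have hP := h.surface.principal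
  have hs := fun q (hq : q ∈ D) => hP.structure_eqs hD (fun q hq => h.dV_sqrtE hD hq) hq
  have hR := (hP.contDiffOn_sqrtE hD).hasFDerivAt_grad hD hp
  have hQ := (hP.contDiffOn_sqrtG hD).hasFDerivAt_grad hD hp
  have hX := (hP.contDiffOn_unitU hD).hasFDerivAt_grad hD hp
  have hY := (hP.contDiffOn_unitV hD).hasFDerivAt_grad hD hp
  have hf := (hU.hasDerivAt_f (hDU p hp)).fst_grad
  have hg := (hU.swap.hasDerivAt_f (hDU p hp)).fst_grad
  have hlu := (hf.smul_grad (hR.smul_grad hX)).neg.congr_of_eqOn hD (h' := dU (unitNormal z))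
    (fun q hq => by
      rw [(hs q hq).2.2.2.2.1, h.surface.nu1_eq q hq]
      simp [smul_smul]) hp
  have hlv := (hg.smul_grad (hQ.smul_grad hY)).neg.congr_of_eqOn hD (h' := dV (unitNormal z))
    (fun q hq => by
      rw [(hs q hq).2.2.2.2.2, h.surface.nu2_eq q hq]
      simp [smul_smul]) hp
  have hmix := dV_dU_comm (hP.contDiffOn_unitNormal hD) hD hp
  rw [dV_eq_fderiv hlu.differentiableAt, hlu.fderiv, dU_eq_fderiv hlv.differentiableAt,
    hlv.fderiv] at hmix
  obtain ⟨-, h2, h3, -⟩ := hs p hp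
  have hE := (hP.sqrtE_pos hp).ne'
  -- The Y-component of l_uv = l_vu is (f - g)(√G)_u = g' ν_u √G, and g' ν_u = J_u (g - f).
  have hm := congrArg (fun x => mink x (unitV z p)) hmix
  simp only [neg_apply, grad_apply, h2, h3, h.dV_sqrtE hD hp] at hm
  simp only [← neg_one_smul ℝ (_ : V3), mink_smul_left, mink_add_left, zero_smul, smul_zero,
    add_zero, zero_add, (hP.orthoFrame hp).YY, one_smul] at hm
  have hJ := hU.deriv_funJ_mul (hDU p hp)
  apply mul_left_cancel₀ (hU.sub_ne (hDU p hp))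
  field_simp at hm
  linear_combination -hm - sqrtG z p * hJ

/-- By Codazzi, γ₂ = J_u/√(-E). Equating this with a e^I J_u and cancelling J_u leaves 1/√(-E) = a
e^I. -/
theorem sqrtE_eq (h : HasInvariants f g S ν u₀ a z D) (hD : IsOpen D) (ha : 0 < a)
    (hU : IsAdmissible f g S ν u₀ U) (hDU : ∀ p ∈ D, p.1 ∈ U) {p : ℝ × ℝ} (hp : p ∈ D) :
    sqrtE z p = scaleE f g ν u₀ a p.1 := by
  have hP := h.surface.principal
  have hG := (hP.sqrtG_pos hp).ne'
  have hE := (hP.sqrtE_pos hp).ne'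
  have hR := (hP.contDiffOn_sqrtG hD).hasFDerivAt_grad hD hp
  have h2 := (hR.smul_grad hR).congr_of_eqOn hD (h' := coefG z)
    (fun q hq => by rw [hP.coefG_eq hq, sq]; rfl) hp
  have h1 := h.gamma2_eq p hp
  rw [gamma2, h2.dU_eq, hP.coefG_eq hp, h.dU_sqrtG hD hU hDU hp] at h1
  change -(_ + _) / (2 * sqrtG z p ^ 2 * sqrtE z p) = _ at h1
  simp only [smul_eq_mul] at h1
  have hJ := hU.deriv_funJ_ne (hDU p hp)
  have h3 : 1 / sqrtE z p = a * Real.exp (funI f g ν u₀ p.1) := by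
    apply mul_right_cancel₀ hJ
    rw [← h1]
    field_simp
    ring
  rw [scaleE, Real.exp_neg, ← one_div_one_div (sqrtE z p), h3]
  have := Real.exp_pos (funI f g ν u₀ p.1)
  field_simp

theorem movingFrame (h : HasInvariants f g S ν u₀ a z D) (hD : IsOpen D) (ha : 0 < a)
    (hU : IsAdmissible f g S ν u₀ U) (hDU : ∀ p ∈ D, p.1 ∈ U) :
    MovingFrame (scaleE f g ν u₀ a) (fun u => f (ν u) * scaleE f g ν u₀ a u)
      (fun u => -deriv (funJ f g ν u₀) u / scaleE f g ν u₀ a u) (fun u => g (ν u)) (sqrtG z)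
      z (unitU z) (unitV z) (unitNormal z) D := by
  have hP := h.surface.principal
  have key : ∀ p ∈ D, _ := fun p hp => hP.structure_eqs hD (fun q hq => h.dV_sqrtE hD hq) hp
  refine ⟨fun p hp => hP.orthoFrame hp, fun p hp => ?_, fun p hp => ?_, fun p hp => ?_,
    fun p hp => ?_⟩
  · rw [← h.sqrtE_eq hD ha hU hDU hp, ← hP.dU_eq hp, ← hP.dV_eq hp]
    exact hP.smooth.hasFDerivAt_grad hD hp
  all_goals
    obtain ⟨h1, h2, h3, h4, h5, h6⟩ := key p hp
    rw [h.surface.nu1_eq p hp] at h1 h5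
    rw [h.surface.nu2_eq p hp] at h4 h6
    rw [h.dU_sqrtG hD hU hDU hp] at h2 h4
    rw [h.sqrtE_eq hD ha hU hDU hp] at h1 h2 h4 h5
    rw [mul_div_right_comm] at h2 h4
  · rw [← h1, ← h2]
    exact (hP.contDiffOn_unitU hD).hasFDerivAt_grad hD hp
  · rw [← h3, ← h4]
    exact (hP.contDiffOn_unitV hD).hasFDerivAt_grad hD hp
  · rw [← h5, ← h6]
    exact (hP.contDiffOn_unitNormal hD).hasFDerivAt_grad hD hp

end HasInvariants

/-- Uniqueness, up to a motion, in parameters with equal coefficients `G`. -/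
theorem HasInvariants.exists_motion {f g : ℝ → ℝ} {S : Set ℝ} {ν : ℝ → ℝ} {u₀ a : ℝ} {U : Set ℝ}
    {z₁ z₂ : ℝ × ℝ → V3} {D₁ D₂ W : Set (ℝ × ℝ)} (h₁ : HasInvariants f g S ν u₀ a z₁ D₁)
    (h₂ : HasInvariants f g S ν u₀ a z₂ D₂) (hD₁ : IsOpen D₁) (hD₂ : IsOpen D₂) (ha : 0 < a)
    (hU : IsAdmissible f g S ν u₀ U) (hDU₁ : ∀ p ∈ D₁, p.1 ∈ U) (hDU₂ : ∀ p ∈ D₂, p.1 ∈ U)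
    (hW : IsOpen W) (hWc : IsConnected W) (hWD : W ⊆ D₁) {φ φ' : ℝ → ℝ}
    (hφ : ∀ p ∈ W, HasDerivAt φ (φ' p.2) p.2) (hφW : ∀ p ∈ W, (p.1, φ p.2) ∈ D₂)
    (hG : ∀ p ∈ W, sqrtG z₁ p = sqrtG z₂ (p.1, φ p.2) * φ' p.2) :
    ∃ T : V3 → V3, IsMotion T ∧ ∀ p ∈ W, z₁ p = T (z₂ (p.1, φ p.2)) := by
  have m₁ := h₁.movingFrame hD₁ ha hU hDU₁ |>.mono hWD
  have m₂ := (h₂.movingFrame hD₂ ha hU hDU₂).comp_snd hφ hφW hG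
  obtain ⟨q, hq⟩ := hWc.nonempty
  exact m₁.rigidity m₂ hW hWc.isPreconnected hq

end TimelikeW

/-! ### Changes of the parameter v -/

theorem ordConnected_real_ball (x r : ℝ) : (Metric.ball x r).OrdConnected := by
  rw [Real.ball_eq_Ioo]; exact ordConnected_Ioo

/-- A change of parameter `φ` carrying the density `c₂` to `c₁`. -/
theorem exists_reparametrization {c₁ c₂ : ℝ → ℝ} {v₀ r : ℝ} (hr : 0 < r)
    (h₁ : ContDiffOn ℝ ∞ c₁ (Metric.ball v₀ r)) (h₂ : ContDiffOn ℝ ∞ c₂ (Metric.ball v₀ r))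
    (p₂ : ∀ v ∈ Metric.ball v₀ r, 0 < c₂ v) :
    ∃ (φ : ℝ → ℝ) (r' : ℝ), 0 < r' ∧ r' ≤ r ∧ φ v₀ = v₀ ∧ ∀ v ∈ Metric.ball v₀ r',
      φ v ∈ Metric.ball v₀ r ∧ ContDiffAt ℝ ∞ φ v ∧ HasDerivAt φ (c₁ v / c₂ (φ v)) v ∧
      ∫ t in v₀..φ v, c₂ t = ∫ t in v₀..v, c₁ t := by
  set V := Metric.ball v₀ r with hV
  have hVo : IsOpen V := Metric.isOpen_ball
  have hVc : V.OrdConnected := ordConnected_real_ball v₀ r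
  have h0 : v₀ ∈ V := Metric.mem_ball_self hr
  set H₁ : ℝ → ℝ := fun s => ∫ t in v₀..s, c₁ t with hH₁
  set H₂ : ℝ → ℝ := fun s => ∫ t in v₀..s, c₂ t with hH₂
  have d₁ : ∀ v ∈ V, HasDerivAt H₁ (c₁ v) v := fun v hv =>
    hasDerivAt_integral_of_ordConnected hVo hVc h₁.continuousOn h0 hv
  have d₂ : ∀ v ∈ V, HasDerivAt H₂ (c₂ v) v := fun v hv =>
    hasDerivAt_integral_of_ordConnected hVo hVc h₂.continuousOn h0 hv
  have s₁ : ∀ v ∈ V, ContDiffAt ℝ ∞ H₁ v := fun v hv =>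
    (contDiffOn_integral_of_ordConnected hVo hVc h₁ h0).contDiffAt (hVo.mem_nhds hv)
  have s₂ : ∀ v ∈ V, ContDiffAt ℝ ∞ H₂ v := fun v hv =>
    (contDiffOn_integral_of_ordConnected hVo hVc h₂ h0).contDiffAt (hVo.mem_nhds hv)
  have hstrict : HasStrictDerivAt H₂ (c₂ v₀) v₀ :=
    (s₂ v₀ h0).hasStrictDerivAt' (d₂ v₀ h0) (by simp)
  have hF := hstrict.hasStrictFDerivAt_equiv (p₂ v₀ h0).ne'
  -- The solution is φ = H₂⁻¹ ∘ H₁. The local inverse of H₂ is restricted to V so that φ takes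
  -- values where c₂ is positive and H₂ is smooth.
  set e := (hF.toOpenPartialHomeomorph H₂).restrOpen V hVo with he
  have hcoe : ∀ x, e x = H₂ x := fun x => rfl
  have hsrc : e.source ⊆ V := by
    rw [he, OpenPartialHomeomorph.restrOpen_source]; exact inter_subset_right
  have h0s : v₀ ∈ e.source := by
    rw [he, OpenPartialHomeomorph.restrOpen_source]
    exact ⟨hF.mem_toOpenPartialHomeomorph_source, h0⟩
  have hH0 : H₁ v₀ = H₂ v₀ := by simp [hH₁, hH₂]
  have ht : ∀ᶠ v in nhds v₀, H₁ v ∈ e.target := by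
    refine (d₁ v₀ h0).continuousAt.eventually_mem (e.open_target.mem_nhds ?_)
    rw [hH0, ← hcoe]
    exact e.map_source h0s
  obtain ⟨r₁, hr₁, hr₁t⟩ := Metric.eventually_nhds_iff_ball.1 ht
  refine ⟨fun v => e.symm (H₁ v), min r₁ r, lt_min hr₁ hr, min_le_right _ _, ?_, ?_⟩
  · change e.symm (H₁ v₀) = v₀
    rw [hH0, ← hcoe]
    exact e.left_inv h0s
  intro v hv
  have hvV : v ∈ V := Metric.ball_subset_ball (min_le_right _ _) hv
  have hvt : H₁ v ∈ e.target := hr₁t v (Metric.ball_subset_ball (min_le_left _ _) hv)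
  have hmem : e.symm (H₁ v) ∈ V := hsrc (e.map_target hvt)
  have hne := (p₂ _ hmem).ne'
  refine ⟨hmem, ?_, ?_, ?_⟩
  · exact ContDiffAt.comp v
      (e.contDiffAt_symm_deriv hne hvt (d₂ _ hmem) (s₂ _ hmem)) (s₁ v hvV)
  · have := (e.hasDerivAt_symm hvt hne (d₂ _ hmem)).comp v (d₁ v hvV)
    rwa [inv_mul_eq_div] at this
  · exact e.right_inv hvt

/-! ### Uniqueness up to a motion -/

namespace TimelikeW

variable {f g : ℝ → ℝ} {S : Set ℝ} {ν : ℝ → ℝ} {u₀ a : ℝ} {U : Set ℝ} {z z₁ z₂ : ℝ × ℝ → V3}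
  {D D₁ D₂ : Set (ℝ × ℝ)}

/-- `√G` separates the variables on a rectangle. -/
theorem HasInvariants.sqrtG_eq (h : HasInvariants f g S ν u₀ a z D) (hD : IsOpen D)
    (hU : IsAdmissible f g S ν u₀ U) (hDU : ∀ p ∈ D, p.1 ∈ U) {v₀ r u v : ℝ}
    (hr : Metric.ball (u₀, v₀) r ⊆ D) (hu : u ∈ Metric.ball u₀ r) (hv : v ∈ Metric.ball v₀ r) :
    sqrtG z (u, v) * Real.exp (funJ f g ν u₀ u) = sqrtG z (u₀, v) := by
  have hmem : ∀ t ∈ Metric.ball u₀ r, (t, v) ∈ D := fun t ht => hr (by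
    rw [← ball_prod_same]; exact ⟨ht, hv⟩)
  have h0 : u₀ ∈ Metric.ball u₀ r :=
    Metric.mem_ball_self (Metric.pos_of_mem_ball hu)
  have hd : ∀ t ∈ Metric.ball u₀ r,
      HasDerivAt (fun t => sqrtG z (t, v) * Real.exp (funJ f g ν u₀ t)) 0 t := by
    intro t ht
    have h1 := (h.surface.principal.contDiffOn_sqrtG hD).hasFDerivAt_grad hD (hmem t ht)
    have hl : HasDerivAt (fun s : ℝ => (s, v)) ((1 : ℝ), (0 : ℝ)) t :=
      (hasDerivAt_id _).prodMk (hasDerivAt_const _ _)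
    have h2 : HasDerivAt (fun s => sqrtG z (s, v)) _ t :=
      HasFDerivAt.comp_hasDerivAt (l := sqrtG z) t h1 hl
    refine (h2.mul (hU.hasDerivAt_funJ (hDU _ (hmem t ht))).exp).congr_deriv ?_
    simp only [grad_apply, h.dU_sqrtG hD hU hDU (hmem t ht), one_smul, zero_smul, add_zero]
    ring
  have := Metric.isOpen_ball.is_const_of_deriv_eq_zero
    (convex_ball u₀ r).isPreconnected
    (fun t ht => (hd t ht).differentiableAt.differentiableWithinAt)
    (fun t ht => (hd t ht).deriv) hu h0
  simpa [funJ_self] using this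

/-- The constant value of √G e^J is found at the base point, where J = 0. -/
theorem IsNatural.sqrtG_eq (h : IsNatural f g (fun p => ν p.1) (ν u₀) z D) {v₀ : ℝ}
    (h₀ : (u₀, v₀) ∈ D) {p : ℝ × ℝ} (hp : p ∈ D) :
    sqrtG z p * Real.exp (funJ f g ν u₀ p.1) = sqrtG z (u₀, v₀) := by
  obtain ⟨c, hc⟩ := h.2
  refine (hc p hp).trans ((hc _ h₀).symm.trans ?_)
  change sqrtG z (u₀, v₀) * Real.exp (funJ f g ν u₀ u₀) = _
  simp [funJ_self]

/-- In natural parameters √G = √G(u₀, v₀) e^{-J} on all of D, so equal normalizations make the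
coefficients G identical; no change of v is needed and rigidity applies on the whole connected
domain. -/
theorem HasInvariants.unique_of_natural (h₁ : HasInvariants f g S ν u₀ a z₁ D)
    (h₂ : HasInvariants f g S ν u₀ a z₂ D) (hD : IsOpen D) (hDc : IsConnected D) (ha : 0 < a)
    (hU : IsAdmissible f g S ν u₀ U) (hDU : ∀ p ∈ D, p.1 ∈ U) {v₀ : ℝ} (h₀ : (u₀, v₀) ∈ D)
    (n₁ : IsNatural f g (fun p => ν p.1) (ν u₀) z₁ D)
    (n₂ : IsNatural f g (fun p => ν p.1) (ν u₀) z₂ D)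
    (hG : coefG z₁ (u₀, v₀) = coefG z₂ (u₀, v₀)) :
    ∃ T : V3 → V3, IsMotion T ∧ ∀ p ∈ D, z₁ p = T (z₂ p) := by
  refine h₁.exists_motion h₂ hD hD ha hU hDU hDU hD hDc subset_rfl (φ := id) (φ' := fun _ => 1)
    (fun p _ => hasDerivAt_id _) (fun p hp => hp) fun p hp => ?_
  rw [mul_one]
  refine mul_right_cancel₀ (Real.exp_pos (funJ f g ν u₀ p.1)).ne' ?_
  rw [n₁.sqrtG_eq h₀ hp]
  refine Eq.trans ?_ (n₂.sqrtG_eq h₀ hp).symm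
  rw [sqrtG, sqrtG, hG]

theorem integral_eq_of_eqOn_ball {c : ℝ → ℝ} {C v₀ r v : ℝ}
    (hc : ∀ t ∈ Metric.ball v₀ r, c t = C) (hv : v ∈ Metric.ball v₀ r) :
    ∫ t in v₀..v, c t = C * (v - v₀) := by
  have h0 : v₀ ∈ Metric.ball v₀ r := Metric.mem_ball_self (Metric.pos_of_mem_ball hv)
  rw [intervalIntegral.integral_congr (g := fun _ => C)
    fun t ht => hc t ((ordConnected_real_ball v₀ r).uIcc_subset h0 hv ht)]
  simp [mul_comm]

/-- On a square around the base point √G e^J depends only on v, so it suffices to match the two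
coefficients along u = u₀, which is an ordinary differential equation for φ. -/
theorem HasInvariants.unique_up_to_parameter (h₁ : HasInvariants f g S ν u₀ a z₁ D₁)
    (h₂ : HasInvariants f g S ν u₀ a z₂ D₂) (hD₁ : IsOpen D₁) (hD₂ : IsOpen D₂) (ha : 0 < a)
    (hU : IsAdmissible f g S ν u₀ U) (hDU₁ : ∀ p ∈ D₁, p.1 ∈ U) (hDU₂ : ∀ p ∈ D₂, p.1 ∈ U)
    {v₀ : ℝ} (m₁ : (u₀, v₀) ∈ D₁) (m₂ : (u₀, v₀) ∈ D₂) :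
    ∃ (T : V3 → V3) (φ : ℝ → ℝ) (W : Set (ℝ × ℝ)),
      IsMotion T ∧ IsOpen W ∧ (u₀, v₀) ∈ W ∧ W ⊆ D₁ ∧ φ v₀ = v₀ ∧
      (∀ p ∈ W, ContDiffAt ℝ ∞ φ p.2 ∧ 0 < deriv φ p.2 ∧ (p.1, φ p.2) ∈ D₂ ∧
        z₁ p = T (z₂ (p.1, φ p.2))) ∧
      (IsNatural f g (fun p => ν p.1) (ν u₀) z₁ D₁ →
        IsNatural f g (fun p => ν p.1) (ν u₀) z₂ D₂ →
        ∃ k : ℝ, 0 < k ∧ ∀ p ∈ W, φ p.2 = v₀ + k * (p.2 - v₀)) := by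
  obtain ⟨r, hr, hrD⟩ := Metric.isOpen_iff.1 (hD₁.inter hD₂) _ ⟨m₁, m₂⟩
  have hr₁ : Metric.ball (u₀, v₀) r ⊆ D₁ := fun p hp => (hrD hp).1
  have hr₂ : Metric.ball (u₀, v₀) r ⊆ D₂ := fun p hp => (hrD hp).2
  have hmem : ∀ {u v : ℝ}, u ∈ Metric.ball u₀ r → v ∈ Metric.ball v₀ r →
      (u, v) ∈ Metric.ball (u₀, v₀) r := fun hu hv => by
    rw [← ball_prod_same]; exact ⟨hu, hv⟩
  have h0 : u₀ ∈ Metric.ball u₀ r := Metric.mem_ball_self hr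
  have hline : ContDiffOn ℝ ∞ (fun v : ℝ => (u₀, v)) (Metric.ball v₀ r) :=
    contDiffOn_const.prodMk contDiffOn_id
  have c₁ : ContDiffOn ℝ ∞ (fun v => sqrtG z₁ (u₀, v)) (Metric.ball v₀ r) :=
    (h₁.surface.principal.contDiffOn_sqrtG hD₁).comp hline fun v hv => hr₁ (hmem h0 hv)
  have c₂ : ContDiffOn ℝ ∞ (fun v => sqrtG z₂ (u₀, v)) (Metric.ball v₀ r) :=
    (h₂.surface.principal.contDiffOn_sqrtG hD₂).comp hline fun v hv => hr₂ (hmem h0 hv)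
  have p₁ : ∀ v ∈ Metric.ball v₀ r, 0 < sqrtG z₁ (u₀, v) := fun v hv =>
    h₁.surface.principal.sqrtG_pos (hr₁ (hmem h0 hv))
  have p₂ : ∀ v ∈ Metric.ball v₀ r, 0 < sqrtG z₂ (u₀, v) := fun v hv =>
    h₂.surface.principal.sqrtG_pos (hr₂ (hmem h0 hv))
  obtain ⟨φ, r', hr', hr'r, hφ0, hφ⟩ := exists_reparametrization hr c₁ c₂ p₂
  set W := Metric.ball (u₀, v₀) r' with hW
  have hWm : ∀ p ∈ W, p.1 ∈ Metric.ball u₀ r ∧ p.2 ∈ Metric.ball v₀ r' := fun p hp => by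
    rw [hW, ← ball_prod_same] at hp
    exact ⟨Metric.ball_subset_ball hr'r hp.1, hp.2⟩
  have hWD : W ⊆ D₁ := (Metric.ball_subset_ball hr'r).trans hr₁
  have hφD : ∀ p ∈ W, (p.1, φ p.2) ∈ D₂ := fun p hp =>
    hr₂ (hmem (hWm p hp).1 (hφ _ (hWm p hp).2).1)
  have hW0 : (u₀, v₀) ∈ W := Metric.mem_ball_self hr'
  obtain ⟨T, hT, hTz⟩ := h₁.exists_motion h₂ hD₁ hD₂ ha hU hDU₁ hDU₂ Metric.isOpen_ball
    ((convex_ball (u₀, v₀) r').isConnected ⟨_, hW0⟩) hWD (φ := φ)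
    (φ' := fun v => sqrtG z₁ (u₀, v) / sqrtG z₂ (u₀, φ v))
    (fun p hp => (hφ _ (hWm p hp).2).2.2.1) hφD (fun p hp => by
      obtain ⟨hp1, hp2⟩ := hWm p hp
      have hq := (hφ _ hp2).1
      have e₁ := h₁.sqrtG_eq hD₁ hU hDU₁ hr₁ hp1 (Metric.ball_subset_ball hr'r hp2)
      have e₂ := h₂.sqrtG_eq hD₂ hU hDU₂ hr₂ hp1 hq
      have := (p₂ _ hq).ne'
      have hexp := (Real.exp_pos (funJ f g ν u₀ p.1)).ne'
      apply mul_right_cancel₀ hexp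
      rw [mul_right_comm, e₂, e₁, mul_div_cancel₀ _ this])
  refine ⟨T, φ, W, hT, Metric.isOpen_ball, hW0, hWD, hφ0, fun p hp => ?_, fun n₁ n₂ => ?_⟩
  · obtain ⟨hp1, hp2⟩ := hWm p hp
    obtain ⟨hq, hs, hd, -⟩ := hφ _ hp2
    refine ⟨hs, ?_, hφD p hp, hTz p hp⟩
    rw [hd.deriv]
    exact div_pos (p₁ _ (Metric.ball_subset_ball hr'r hp2)) (p₂ _ hq)
  · have hv0 : v₀ ∈ Metric.ball v₀ r := Metric.mem_ball_self hr
    have k₁ := p₁ v₀ hv0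
    have k₂ := p₂ v₀ hv0
    refine ⟨sqrtG z₁ (u₀, v₀) / sqrtG z₂ (u₀, v₀), div_pos k₁ k₂, fun p hp => ?_⟩
    obtain ⟨hp1, hp2⟩ := hWm p hp
    obtain ⟨hq, -, -, hi⟩ := hφ _ hp2
    have i₁ : ∀ t ∈ Metric.ball v₀ r, sqrtG z₁ (u₀, t) = sqrtG z₁ (u₀, v₀) := fun t ht => by
      simpa [funJ_self] using n₁.sqrtG_eq m₁ (hr₁ (hmem h0 ht))
    have i₂ : ∀ t ∈ Metric.ball v₀ r, sqrtG z₂ (u₀, t) = sqrtG z₂ (u₀, v₀) := fun t ht => by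
      simpa [funJ_self] using n₂.sqrtG_eq m₂ (hr₂ (hmem h0 ht))
    -- Both densities are constant in natural parameters, so the integral identity defining φ
    -- becomes a linear equation for φ(v).
    rw [integral_eq_of_eqOn_ball i₂ hq,
      integral_eq_of_eqOn_ball i₁ (Metric.ball_subset_ball hr'r hp2)] at hi
    have := k₂.ne'
    field_simp
    linarith

end TimelikeW

/-! ### Explicit surfaces and their invariants -/

/-- Generalized trigonometric functions: `c'' = μ c`, `s' = c`, `k' = s`. -/
theorem exists_generalized_trig (μ : ℝ) : ∃ c s k : ℝ → ℝ,
    ContDiff ℝ ∞ s ∧ ContDiff ℝ ∞ k ∧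
    (∀ t, HasDerivAt s (c t) t) ∧ (∀ t, HasDerivAt k (s t) t) ∧ (∀ t, c t = 1 + μ * k t) ∧
    ∀ t, s t ^ 2 = k t * (c t + 1) := by
  rcases lt_trichotomy μ 0 with hμ | rfl | hμ
  · obtain ⟨w, hw, rfl⟩ : ∃ w : ℝ, 0 < w ∧ μ = -w ^ 2 :=
      ⟨Real.sqrt (-μ), Real.sqrt_pos.2 (neg_pos.2 hμ), by
        rw [Real.sq_sqrt (neg_pos.2 hμ).le, neg_neg]⟩
    have hd : ∀ t : ℝ, HasDerivAt (fun t => w * t) w t := fun t => by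
      simpa using (hasDerivAt_id t).const_mul w
    refine ⟨fun t => Real.cos (w * t), fun t => Real.sin (w * t) / w,
      fun t => (1 - Real.cos (w * t)) / w ^ 2, ?_, ?_, fun t => ?_, fun t => ?_, fun t => ?_,
      fun t => ?_⟩
    · exact (Real.contDiff_sin.comp (contDiff_const.mul contDiff_id)).div_const w
    · exact (contDiff_const.sub
        (Real.contDiff_cos.comp (contDiff_const.mul contDiff_id))).div_const _
    · refine ((hd t).sin.div_const w).congr_deriv ?_
      field_simp
    · refine (((hd t).cos.const_sub 1).div_const (w ^ 2)).congr_deriv ?_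
      field_simp
    · field_simp; ring
    · have := Real.sin_sq_add_cos_sq (w * t)
      field_simp
      linear_combination this
  · refine ⟨fun _ => 1, fun t => t, fun t => t ^ 2 / 2, contDiff_id,
      (contDiff_id.pow 2).div_const 2, fun t => hasDerivAt_id t, fun t => ?_, fun t => by simp,
      fun t => by ring⟩
    refine (((hasDerivAt_id t).pow 2).div_const 2).congr_deriv ?_
    simp
  · obtain ⟨w, hw, rfl⟩ : ∃ w : ℝ, 0 < w ∧ μ = w ^ 2 :=
      ⟨Real.sqrt μ, Real.sqrt_pos.2 hμ, by rw [Real.sq_sqrt hμ.le]⟩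
    have hd : ∀ t : ℝ, HasDerivAt (fun t => w * t) w t := fun t => by
      simpa using (hasDerivAt_id t).const_mul w
    refine ⟨fun t => Real.cosh (w * t), fun t => Real.sinh (w * t) / w,
      fun t => (Real.cosh (w * t) - 1) / w ^ 2, ?_, ?_, fun t => ?_, fun t => ?_, fun t => ?_,
      fun t => ?_⟩
    · exact (Real.contDiff_sinh.comp (contDiff_const.mul contDiff_id)).div_const w
    · exact ((Real.contDiff_cosh.comp (contDiff_const.mul contDiff_id)).sub
        contDiff_const).div_const _
    · refine ((hd t).sinh.div_const w).congr_deriv ?_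
      field_simp
    · refine (((hd t).cosh.sub_const 1).div_const (w ^ 2)).congr_deriv ?_
      field_simp
    · field_simp; ring
    · have := Real.cosh_sq_sub_sinh_sq (w * t)
      field_simp
      linear_combination -this

theorem HasFDerivAt.vec3 {a b c : ℝ × ℝ → ℝ} {a₁ a₂ b₁ b₂ c₁ c₂ : ℝ} {p : ℝ × ℝ} {x y : V3}
    (ha : HasFDerivAt a (grad a₁ a₂) p) (hb : HasFDerivAt b (grad b₁ b₂) p)
    (hc : HasFDerivAt c (grad c₁ c₂) p) (hx : x = ![a₁, b₁, c₁]) (hy : y = ![a₂, b₂, c₂]) :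
    HasFDerivAt (fun q => (![a q, b q, c q] : V3)) (grad x y) p := by
  subst hx hy
  refine hasFDerivAt_pi'.2 fun i => ?_
  fin_cases i
  · exact ha.congr_fderiv (by ext <;> simp [grad_apply])
  · exact hb.congr_fderiv (by ext <;> simp [grad_apply])
  · exact hc.congr_fderiv (by ext <;> simp [grad_apply])

theorem HasFDerivAt.mul_separated {A B C : ℝ → ℝ} {A' B' C' : ℝ} {p : ℝ × ℝ}
    (hC : HasDerivAt C C' p.1) (hA : HasDerivAt A A' p.1) (hB : HasDerivAt B B' p.2) :
    HasFDerivAt (fun q : ℝ × ℝ => C q.1 + A q.1 * B q.2)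
      (grad (C' + A' * B p.2) (A p.1 * B')) p := by
  refine (hC.fst_grad.add (hA.fst_grad.mul hB.snd_grad)).congr_fderiv ?_
  ext <;> simp [grad_apply, mul_comm]

/-- The surfaces whose structure equations have coefficients independent of `v`, in explicit
form. -/
theorem exists_movingFrame_of_hyperbolic {P m k n Q ch sh ζc ζs : ℝ → ℝ} {q₀ p₀ : ℝ} {U : Set ℝ}
    (hch : ∀ u ∈ U, HasDerivAt ch (m u * sh u) u) (hsh : ∀ u ∈ U, HasDerivAt sh (m u * ch u) u)
    (hone : ∀ u ∈ U, ch u ^ 2 - sh u ^ 2 = 1)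
    (hk : ∀ u ∈ U, k u * Q u = ch u * q₀ + sh u * p₀)
    (hn : ∀ u ∈ U, n u * Q u = sh u * q₀ + ch u * p₀)
    (hζc : ∀ u ∈ U, HasDerivAt ζc (P u * ch u) u) (hζs : ∀ u ∈ U, HasDerivAt ζs (P u * sh u) u)
    (hQ : ∀ u ∈ U, HasDerivAt Q (k u * Q u * P u) u)
    (hsmooth : ContDiffOn ℝ ∞ ζc U ∧ ContDiffOn ℝ ∞ ζs U ∧ ContDiffOn ℝ ∞ Q U) :
    ∃ z X Y l : ℝ × ℝ → V3, ContDiffOn ℝ ∞ z (U ×ˢ univ) ∧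
      MovingFrame P m k n (fun p => Q p.1) z X Y l (U ×ˢ univ) := by
  -- The constant is μ = α² - β², for which Y_vv = μY. The relation s² = κ(c + 1) stands in for c² -
  -- μs² = 1, which would say nothing about s when μ = 0.
  obtain ⟨c, s, κ, hs, hκ, ds, dκ, hc, hsq⟩ := exists_generalized_trig (q₀ ^ 2 - p₀ ^ 2)
  have dc : ∀ t, HasDerivAt c ((q₀ ^ 2 - p₀ ^ 2) * s t) t := fun t => by
    rw [show c = fun t => 1 + (q₀ ^ 2 - p₀ ^ 2) * κ t from funext hc]
    exact ((dκ t).const_mul _).const_add 1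
  set A : ℝ → ℝ := fun u => ch u * q₀ + sh u * p₀ with hA
  set B : ℝ → ℝ := fun u => sh u * q₀ + ch u * p₀ with hB
  have dA : ∀ u ∈ U, HasDerivAt A (m u * B u) u := fun u hu =>
    (((hch u hu).mul_const q₀).add ((hsh u hu).mul_const p₀)).congr_deriv (by simp only [hB]; ring)
  have dB : ∀ u ∈ U, HasDerivAt B (m u * A u) u := fun u hu =>
    (((hsh u hu).mul_const q₀).add ((hch u hu).mul_const p₀)).congr_deriv (by simp only [hA]; ring)
  have hAB : ∀ u ∈ U, A u ^ 2 - B u ^ 2 = q₀ ^ 2 - p₀ ^ 2 := fun u hu => by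
    simp only [hA, hB]
    linear_combination (q₀ ^ 2 - p₀ ^ 2) * hone u hu
  -- With w = (0, p₀, q₀), solving in v gives Y = c e₁ + s w. Then X_v = A Y and l_v = -B Y are
  -- integrated from (0, -sh, ch) and (0, ch, -sh) at v = 0, and z_v = Q Y from the plane curve (0,
  -- -ζs, ζc). The summands 0 and factors 1 fit the pattern C(u) + A(u)B(v) of
  -- `HasFDerivAt.mul_separated`.
  refine ⟨fun p => ![0 + Q p.1 * s p.2, -ζs p.1 + Q p.1 * (κ p.2 * p₀),
      ζc p.1 + Q p.1 * (κ p.2 * q₀)],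
    fun p => ![0 + A p.1 * s p.2, -sh p.1 + A p.1 * (κ p.2 * p₀), ch p.1 + A p.1 * (κ p.2 * q₀)],
    fun p => ![0 + 1 * c p.2, 0 + 1 * (s p.2 * p₀), 0 + 1 * (s p.2 * q₀)],
    fun p => ![0 + -B p.1 * s p.2, ch p.1 + -B p.1 * (κ p.2 * p₀),
      -sh p.1 + -B p.1 * (κ p.2 * q₀)], ?_, ?_, ?_, ?_, ?_, ?_⟩
  · obtain ⟨h1, h2, h3⟩ := hsmooth
    have hf : ∀ {φ : ℝ → ℝ}, ContDiffOn ℝ ∞ φ U →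
        ContDiffOn ℝ ∞ (fun p : ℝ × ℝ => φ p.1) (U ×ˢ univ) := fun hφ =>
      hφ.comp contDiffOn_fst fun p hp => hp.1
    have hg : ∀ {φ : ℝ → ℝ}, ContDiff ℝ ∞ φ →
        ContDiffOn ℝ ∞ (fun p : ℝ × ℝ => φ p.2) (U ×ˢ univ) := fun hφ =>
      (hφ.comp contDiff_snd).contDiffOn
    refine contDiffOn_pi.2 fun i => ?_
    fin_cases i
    · exact contDiffOn_const.add ((hf h3).mul (hg hs))
    · exact (hf h2).neg.add ((hf h3).mul ((hg hκ).mul contDiffOn_const))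
    · exact (hf h1).add ((hf h3).mul ((hg hκ).mul contDiffOn_const))
  · intro p hp
    have h1 := hone p.1 hp.1
    have h2 := hsq p.2
    rw [hc p.2] at h2
    refine ⟨?_, ?_, ?_, ?_⟩
    · simp [mink, hA]
      linear_combination A p.1 ^ 2 * h2 - h1
    · simp [mink, hc p.2]
      linear_combination -(q₀ ^ 2 - p₀ ^ 2) * h2
    · simp [mink, hA, hc p.2]
      ring
    · ext i
      fin_cases i
      · simp [lcross, hA, hB]; ring
      · simp [lcross, hA, hB, hc p.2]
        linear_combination -A p.1 * q₀ * h2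
      · simp [lcross, hA, hB, hc p.2]
        linear_combination -A p.1 * p₀ * h2
  · intro p hp
    have hQp := hQ p.1 hp.1
    rw [hk p.1 hp.1] at hQp
    refine HasFDerivAt.vec3
      (HasFDerivAt.mul_separated (hasDerivAt_const _ _) hQp (ds p.2))
      (HasFDerivAt.mul_separated (hζs p.1 hp.1).neg hQp ((dκ p.2).mul_const p₀))
      (HasFDerivAt.mul_separated (hζc p.1 hp.1) hQp ((dκ p.2).mul_const q₀)) ?_ ?_
    · ext i
      fin_cases i <;> simp [hA] <;> ring
    · ext i
      fin_cases i <;> simp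
  · intro p hp
    rw [hk p.1 hp.1]
    refine HasFDerivAt.vec3
      (HasFDerivAt.mul_separated (hasDerivAt_const _ _) (dA p.1 hp.1) (ds p.2))
      (HasFDerivAt.mul_separated (hsh p.1 hp.1).neg (dA p.1 hp.1) ((dκ p.2).mul_const p₀))
      (HasFDerivAt.mul_separated (hch p.1 hp.1) (dA p.1 hp.1) ((dκ p.2).mul_const q₀)) ?_ ?_
    · ext i
      fin_cases i <;> simp <;> ring
    · ext i
      fin_cases i <;> simp [hA]
  · intro p hp
    rw [hk p.1 hp.1, hn p.1 hp.1]
    refine HasFDerivAt.vec3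
      (HasFDerivAt.mul_separated (hasDerivAt_const _ _) (hasDerivAt_const _ _) (dc p.2))
      (HasFDerivAt.mul_separated (hasDerivAt_const _ _) (hasDerivAt_const _ _)
        ((ds p.2).mul_const p₀))
      (HasFDerivAt.mul_separated (hasDerivAt_const _ _) (hasDerivAt_const _ _)
        ((ds p.2).mul_const q₀)) ?_ ?_
    · ext i
      fin_cases i <;> simp
    · have h1 := hone p.1 hp.1
      ext i
      fin_cases i <;> simp [hA, hB, hc p.2]
      · linear_combination (q₀ ^ 2 - p₀ ^ 2) * s p.2 * h1
      · linear_combination (p₀ + (q₀ ^ 2 - p₀ ^ 2) * κ p.2 * p₀) * h1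
      · linear_combination (q₀ + (q₀ ^ 2 - p₀ ^ 2) * κ p.2 * q₀) * h1
  · intro p hp
    rw [hn p.1 hp.1]
    refine HasFDerivAt.vec3
      (HasFDerivAt.mul_separated (hasDerivAt_const _ _) (dB p.1 hp.1).neg (ds p.2))
      (HasFDerivAt.mul_separated (hch p.1 hp.1) (dB p.1 hp.1).neg ((dκ p.2).mul_const p₀))
      (HasFDerivAt.mul_separated (hsh p.1 hp.1).neg (dB p.1 hp.1).neg ((dκ p.2).mul_const q₀)) ?_ ?_
    · ext i
      fin_cases i <;> simp <;> ring
    · ext i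
      fin_cases i <;> simp [hB]

/-- The invariants of a surface, read off from its structure equations. -/
theorem MovingFrame.invariants {P m k n Q P' : ℝ → ℝ} {z X Y l : ℝ × ℝ → V3} {W : Set (ℝ × ℝ)}
    (h : MovingFrame P m k n (fun p => Q p.1) z X Y l W) (hW : IsOpen W)
    (hP : ∀ p ∈ W, 0 < P p.1) (hQ : ∀ p ∈ W, 0 < Q p.1)
    (dP : ∀ p ∈ W, HasDerivAt P (P' p.1) p.1)
    (dQ : ∀ p ∈ W, HasDerivAt Q (k p.1 * Q p.1 * P p.1) p.1) {p : ℝ × ℝ} (hp : p ∈ W) :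
    coefE z p = -P p.1 ^ 2 ∧ coefF z p = 0 ∧ coefG z p = Q p.1 ^ 2 ∧ coefM z p = 0 ∧
      nu1 z p = m p.1 / P p.1 ∧ nu2 z p = n p.1 ∧ gamma1 z p = 0 ∧ gamma2 z p = -k p.1 := by
  have hzu : ∀ p ∈ W, dU z p = P p.1 • X p := fun p hp => (h.dz p hp).dU_eq
  have hzv : ∀ p ∈ W, dV z p = Q p.1 • Y p := fun p hp => (h.dz p hp).dV_eq
  have hE : ∀ p ∈ W, coefE z p = -P p.1 ^ 2 := fun p hp => by
    rw [coefE, hzu p hp, mink_smul_left, mink_smul_right, (h.ortho p hp).XX]; ring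
  have hF : ∀ p ∈ W, coefF z p = 0 := fun p hp => by
    rw [coefF, hzu p hp, hzv p hp, mink_smul_left, mink_smul_right, (h.ortho p hp).XY]; ring
  have hG : ∀ p ∈ W, coefG z p = Q p.1 ^ 2 := fun p hp => by
    rw [coefG, hzv p hp, mink_smul_left, mink_smul_right, (h.ortho p hp).YY]; ring
  have hl : unitNormal z p = l p := by
    have h1 : (0 : ℝ) ^ 2 - -P p.1 ^ 2 * Q p.1 ^ 2 = (P p.1 * Q p.1) ^ 2 := by ring
    have h2 := mul_pos (hP p hp) (hQ p hp)
    rw [unitNormal, hE p hp, hF p hp, hG p hp, hzu p hp, hzv p hp, lcross_smul_smul, h1,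
      Real.sqrt_sq h2.le, inv_smul_smul₀ h2.ne', (h.ortho p hp).cross]
  have o := h.ortho p hp
  have hzu' := ((dP p hp).fst_grad.smul_grad (h.dX p hp)).congr_of_eqOn hW hzu hp
  have hzv' := ((dQ p hp).fst_grad.smul_grad (h.dY p hp)).congr_of_eqOn hW hzv hp
  have lX : mink (l p) (X p) = 0 := by rw [mink_comm, o.Xl]
  have lY : mink (l p) (Y p) = 0 := by rw [mink_comm, o.Yl]
  have hPp := (hP p hp).ne'
  have hQp := (hQ p hp).ne'
  have hEv : dV (coefE z) p = 0 :=
    (((dP p hp).pow 2).neg.fst_grad.congr_of_eqOn hW hE hp).dV_eq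
  have hGu : dU (coefG z) p = _ := (((dQ p hp).pow 2).fst_grad.congr_of_eqOn hW hG hp).dU_eq
  refine ⟨hE p hp, hF p hp, hG p hp, ?_, ?_, ?_, ?_, ?_⟩
  · rw [coefM, hl, hzu'.dV_eq]
    simp only [mink_add_right, mink_smul_right, lX, lY]
    ring
  · rw [nu1, coefL, hl, hzu'.dU_eq, hE p hp]
    simp only [mink_add_right, mink_smul_right, lX, o.ll]
    field_simp
    ring
  · rw [nu2, coefN, hl, hzv'.dV_eq, hG p hp]
    simp only [mink_add_right, mink_smul_right, lX, lY, o.ll]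
    field_simp
    ring
  · rw [gamma1, hEv, zero_div]
  · rw [gamma2, hGu, hE p hp, hG p hp, neg_neg, Real.sqrt_sq (hP p hp).le]
    field_simp
    ring

/-! ### Existence -/

namespace TimelikeW

variable {f g : ℝ → ℝ} {S : Set ℝ} {ν : ℝ → ℝ} {u₀ a : ℝ} {U : Set ℝ}

/-- The data depend on u alone and the explicit solution is entire in v. The domain is therefore a
full strip, the same for every b. -/
theorem exists_surface (ha : 0 < a) (hU : IsAdmissible f g S ν u₀ U) (hUc : U.OrdConnected)
    (hode : ∀ u ∈ U, NaturalODE f g ν u₀ a u) {b : ℝ} (hb : 0 < b) :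
    ∃ z : ℝ × ℝ → V3, HasInvariants f g S ν u₀ a z (U ×ˢ univ) ∧
      IsNatural f g (fun p => ν p.1) (ν u₀) z (U ×ˢ univ) ∧
      ∀ v₀, b ^ 2 * coefG z (u₀, v₀) = 1 := by
  set I := funI f g ν u₀ with hI
  set J := funJ f g ν u₀ with hJ
  set P := scaleE f g ν u₀ a with hP
  set m : ℝ → ℝ := fun u => f (ν u) * P u with hm
  set k : ℝ → ℝ := fun u => -(a * Real.exp (I u) * deriv J u) with hk
  set n : ℝ → ℝ := fun u => g (ν u) with hn
  set Q : ℝ → ℝ := fun u => b⁻¹ * Real.exp (-J u) with hQ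
  have sP : ContDiffOn ℝ ∞ P U := hU.contDiffOn_funI.neg.exp.div_const a
  have sm : ContDiffOn ℝ ∞ m U := hU.contDiffOn_f.mul sP
  have dP : ∀ u ∈ U, HasDerivAt P (deriv P u) u := fun u hu =>
    sP.hasDerivAt_of_isOpen hU.isOpen hu
  have Ppos : ∀ u, 0 < P u := fun u => div_pos (Real.exp_pos _) ha
  have Qpos : ∀ u, 0 < Q u := fun u => mul_pos (inv_pos.2 hb) (Real.exp_pos _)
  have aexp : ∀ u, a * Real.exp (I u) * P u = 1 := fun u => by
    simp only [hP, scaleE, Real.exp_neg, ← hI]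
    have := (Real.exp_pos (I u)).ne'
    field_simp
  have hkP : ∀ u, k u * P u = -deriv J u := fun u => by
    simp only [hk]
    linear_combination -deriv J u * aexp u
  have dQ : ∀ u ∈ U, HasDerivAt Q (k u * Q u * P u) u := fun u hu => by
    refine ((hU.hasDerivAt_funJ hu).neg.exp.const_mul b⁻¹).congr_deriv ?_
    rw [mul_right_comm, hkP]
    simp only [hQ, ← hJ, Pi.neg_apply]
    ring
  set θ : ℝ → ℝ := fun u => ∫ t in u₀..u, m t with hθ
  have dθ : ∀ u ∈ U, HasDerivAt θ (m u) u := fun u hu =>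
    hasDerivAt_integral_of_ordConnected hU.isOpen hUc sm.continuousOn hU.mem hu
  have sθ : ContDiffOn ℝ ∞ θ U :=
    contDiffOn_integral_of_ordConnected hU.isOpen hUc sm hU.mem
  set ch : ℝ → ℝ := fun u => Real.cosh (θ u) with hch
  set sh : ℝ → ℝ := fun u => Real.sinh (θ u) with hsh
  have dch : ∀ u ∈ U, HasDerivAt ch (m u * sh u) u := fun u hu =>
    (dθ u hu).cosh.congr_deriv (mul_comm _ _)
  have dsh : ∀ u ∈ U, HasDerivAt sh (m u * ch u) u := fun u hu =>
    (dθ u hu).sinh.congr_deriv (mul_comm _ _)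
  have hone : ∀ u, ch u ^ 2 - sh u ^ 2 = 1 := fun u => Real.cosh_sq_sub_sinh_sq _
  -- The Gauss equation: the left side differentiates to -a e^I (J_uu + I_u J_u - J_u²) Q, which the
  -- natural ODE turns into f g P Q, as P = e^{-I}/a.
  have dα : ∀ u ∈ U, HasDerivAt (fun u => k u * Q u) (m u * (n u * Q u)) u := fun u hu => by
    have dJ' := hU.contDiffOn_deriv_funJ.hasDerivAt_of_isOpen hU.isOpen hu
    refine (((((hU.hasDerivAt_funI hu).exp.const_mul a).mul dJ').neg).mul (dQ u hu)).congr_deriv ?_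
    have h1 := hode u hu
    rw [NaturalODE, two_mul, Real.exp_add] at h1
    have h2 := aexp u
    simp only [Pi.neg_apply, Pi.mul_apply, hm, hk, hn, ← hI, ← hJ] at h1 ⊢
    have hp := Ppos u
    have h3 : a * Real.exp (I u) = (P u)⁻¹ := eq_inv_of_mul_eq_one_left h2
    have h4 : a ^ 2 * (Real.exp (I u) * Real.exp (I u)) = (P u)⁻¹ ^ 2 := by rw [← h3]; ring
    rw [h4] at h1
    have h5 : f (ν u) * g (ν u) * P u ^ 2 =
        -(deriv (deriv J) u + deriv I u * deriv J u - deriv J u ^ 2) := by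
      have h6 : f (ν u) * g (ν u) = -((P u)⁻¹ ^ 2 *
        (deriv (deriv J) u + deriv I u * deriv J u - deriv J u ^ 2)) := by linarith
      rw [h6]; field_simp
    have h7 : a * (Real.exp (I u) * deriv I u) = (P u)⁻¹ * deriv I u := by rw [← h3]; ring
    rw [h7, h3]
    field_simp
    linear_combination -(Q u) * h5
  -- The Codazzi equation, a consequence of J_u (g - f) = g' ν_u.
  have dβ : ∀ u ∈ U, HasDerivAt (fun u => n u * Q u) (m u * (k u * Q u)) u := fun u hu => by
    refine ((hU.swap.hasDerivAt_f hu).mul (dQ u hu)).congr_deriv ?_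
    have h1 := hU.deriv_funJ_mul hu
    have h2 := hkP u
    simp only [hm, ← hJ] at h1 ⊢
    linear_combination -Q u * h1 + (g (ν u) - f (ν u)) * Q u * h2
  have hcst : ∀ w : ℝ → ℝ, (∀ u ∈ U, HasDerivAt w 0 u) → ∀ u ∈ U, w u = w u₀ := fun w hw u hu =>
    hU.isOpen.is_const_of_deriv_eq_zero hUc.isPreconnected
      (fun x hx => (hw x hx).differentiableAt.differentiableWithinAt)
      (fun x hx => (hw x hx).deriv) hu hU.mem
  -- Undoing the hyperbolic rotation by θ turns the solution (α, β) of the linear system into the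
  -- constant vector (q₀, p₀).
  have c₁ := hcst (fun u => ch u * (k u * Q u) - sh u * (n u * Q u)) fun u hu =>
    (((dch u hu).mul (dα u hu)).sub ((dsh u hu).mul (dβ u hu))).congr_deriv (by ring)
  have c₂ := hcst (fun u => ch u * (n u * Q u) - sh u * (k u * Q u)) fun u hu =>
    (((dch u hu).mul (dβ u hu)).sub ((dsh u hu).mul (dα u hu))).congr_deriv (by ring)
  set q₀ := ch u₀ * (k u₀ * Q u₀) - sh u₀ * (n u₀ * Q u₀)
  set p₀ := ch u₀ * (n u₀ * Q u₀) - sh u₀ * (k u₀ * Q u₀)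
  have sch : ContDiffOn ℝ ∞ (fun t => P t * ch t) U := sP.mul sθ.cosh
  have ssh : ContDiffOn ℝ ∞ (fun t => P t * sh t) U := sP.mul sθ.sinh
  obtain ⟨z, X, Y, l, hz, hF⟩ := exists_movingFrame_of_hyperbolic (P := P) (k := k) (n := n)
    (Q := Q) (q₀ := q₀) (p₀ := p₀) dch dsh (fun u _ => hone u)
    (fun u hu => by
      linear_combination -(k u * Q u) * hone u + ch u * c₁ u hu + sh u * c₂ u hu)
    (fun u hu => by
      linear_combination -(n u * Q u) * hone u + sh u * c₁ u hu + ch u * c₂ u hu)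
    (fun u hu => hasDerivAt_integral_of_ordConnected hU.isOpen hUc sch.continuousOn hU.mem hu)
    (fun u hu => hasDerivAt_integral_of_ordConnected hU.isOpen hUc ssh.continuousOn hU.mem hu)
    dQ ⟨contDiffOn_integral_of_ordConnected hU.isOpen hUc sch hU.mem,
      contDiffOn_integral_of_ordConnected hU.isOpen hUc ssh hU.mem,
      contDiffOn_const.mul hU.contDiffOn_funJ.neg.exp⟩
  have inv : ∀ p ∈ U ×ˢ (univ : Set ℝ), _ := fun p hp =>
    hF.invariants (hU.isOpen.prod isOpen_univ) (fun p _ => Ppos p.1) (fun p _ => Qpos p.1)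
      (fun p hp => dP p.1 hp.1) (fun p hp => dQ p.1 hp.1) hp
  have hν₁ : ∀ p ∈ U ×ˢ (univ : Set ℝ), nu1 z p = f (ν p.1) := fun p hp => by
    rw [(inv p hp).2.2.2.2.1, hm]
    exact mul_div_cancel_right₀ _ (Ppos p.1).ne'
  have hν₂ : ∀ p ∈ U ×ˢ (univ : Set ℝ), nu2 z p = g (ν p.1) := fun p hp =>
    (inv p hp).2.2.2.2.2.1
  refine ⟨z, ⟨⟨⟨hz, fun p hp => ?_, fun p hp => ?_, fun p hp => (inv p hp).2.1,
    fun p hp => (inv p hp).2.2.2.1, fun p hp => ?_⟩, hU.pair, fun p hp => hU.mapsTo hp.1,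
    hν₁, hν₂⟩, fun p hp => (inv p hp).2.2.2.2.2.2.1, fun p hp => ?_⟩,
    ⟨⟨a⁻¹, fun p hp => ?_⟩, ⟨b⁻¹, fun p hp => ?_⟩⟩, fun v₀ => ?_⟩
  · rw [(inv p hp).1]
    exact neg_neg_of_pos (pow_pos (Ppos _) 2)
  · rw [(inv p hp).2.2.1]
    exact pow_pos (Qpos _) 2
  · rw [hν₁ p hp, hν₂ p hp]
    exact sub_ne_zero.1 (hU.sub_ne hp.1)
  · rw [(inv p hp).2.2.2.2.2.2.2]
    simp [hk, hI, hJ]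
  · rw [(inv p hp).1, neg_neg, Real.sqrt_sq (Ppos _).le]
    have := aexp p.1
    change P p.1 * Real.exp (I p.1) = _
    exact eq_inv_of_mul_eq_one_left (by linarith)
  · rw [(inv p hp).2.2.1, Real.sqrt_sq (Qpos _).le]
    change b⁻¹ * Real.exp (-J p.1) * Real.exp (J p.1) = _
    rw [mul_assoc, ← Real.exp_add, neg_add_cancel, Real.exp_zero, mul_one]
  · rw [(inv (u₀, v₀) ⟨hU.mem, mem_univ _⟩).2.2.1]
    simp only [hQ, hJ, funJ_self]
    have := hb.ne'
    field_simp
    simp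

theorem IsTimelikePrincipal.mono {z : ℝ × ℝ → V3} {D D' : Set (ℝ × ℝ)}
    (h : IsTimelikePrincipal z D) (hD : D' ⊆ D) : IsTimelikePrincipal z D' :=
  ⟨h.smooth.mono hD, fun p hp => h.E_neg p (hD hp), fun p hp => h.G_pos p (hD hp),
    fun p hp => h.F_zero p (hD hp), fun p hp => h.M_zero p (hD hp), fun p hp => h.nu_ne p (hD hp)⟩

theorem HasInvariants.mono {z : ℝ × ℝ → V3} {D D' : Set (ℝ × ℝ)}
    (h : HasInvariants f g S ν u₀ a z D) (hD : D' ⊆ D) : HasInvariants f g S ν u₀ a z D' :=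
  ⟨⟨h.surface.principal.mono hD, h.surface.pair, fun p hp => h.surface.w_mem p (hD hp),
    fun p hp => h.surface.nu1_eq p (hD hp), fun p hp => h.surface.nu2_eq p (hD hp)⟩,
    fun p hp => h.gamma1_eq p (hD hp), fun p hp => h.gamma2_eq p (hD hp)⟩

theorem IsNatural.mono {w : ℝ × ℝ → ℝ} {s₀ : ℝ} {z : ℝ × ℝ → V3} {D D' : Set (ℝ × ℝ)}
    (h : IsNatural f g w s₀ z D) (hD : D' ⊆ D) : IsNatural f g w s₀ z D' :=
  ⟨h.1.imp fun _ hc p hp => hc p (hD hp), h.2.imp fun _ hc p hp => hc p (hD hp)⟩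

end TimelikeW

/-! ### The theorem -/

theorem theorem3p7
    (f g : ℝ → ℝ) (S : Set ℝ) (hfg : IsWeingartenPair f g S)
    (D : Set (ℝ × ℝ)) (hD : IsOpen D) (u₀ v₀ : ℝ) (h₀ : (u₀, v₀) ∈ D)
    (ν : ℝ → ℝ) (hν : ContDiffOn ℝ ∞ ν (Prod.fst '' D))
    (hνu : ∀ p ∈ D, deriv ν p.1 ≠ 0) (hνS : ∀ p ∈ D, ν p.1 ∈ S)
    (a : ℝ) (ha : 0 < a) (hode : ∀ p ∈ D, NaturalODE f g ν u₀ a p.1) :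
    -- existence, in natural principal parameters, with any normalization of `G`
    (∃ D₀ : Set (ℝ × ℝ), IsOpen D₀ ∧ IsConnected D₀ ∧ (u₀, v₀) ∈ D₀ ∧ D₀ ⊆ D ∧
      ∀ b : ℝ, 0 < b → ∃ z : ℝ × ℝ → V3,
        HasInvariants f g S ν u₀ a z D₀ ∧
        IsNatural f g (fun p => ν p.1) (ν u₀) z D₀ ∧
        b ^ 2 * coefG z (u₀, v₀) = 1) ∧
    -- uniqueness of the surface up to a motion (and up to the choice of the parameter `v`)
    (∀ (D₁ D₂ : Set (ℝ × ℝ)) (z₁ z₂ : ℝ × ℝ → V3),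
      IsOpen D₁ → IsOpen D₂ → (u₀, v₀) ∈ D₁ → (u₀, v₀) ∈ D₂ → D₁ ⊆ D → D₂ ⊆ D →
      HasInvariants f g S ν u₀ a z₁ D₁ → HasInvariants f g S ν u₀ a z₂ D₂ →
      ∃ (T : V3 → V3) (φ : ℝ → ℝ) (W : Set (ℝ × ℝ)),
        IsMotion T ∧ IsOpen W ∧ (u₀, v₀) ∈ W ∧ W ⊆ D₁ ∧ φ v₀ = v₀ ∧
        (∀ p ∈ W, ContDiffAt ℝ ∞ φ p.2 ∧ 0 < deriv φ p.2 ∧ (p.1, φ p.2) ∈ D₂ ∧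
          z₁ p = T (z₂ (p.1, φ p.2))) ∧
        (IsNatural f g (fun p => ν p.1) (ν u₀) z₁ D₁ →
          IsNatural f g (fun p => ν p.1) (ν u₀) z₂ D₂ →
          ∃ k : ℝ, 0 < k ∧ ∀ p ∈ W, φ p.2 = v₀ + k * (p.2 - v₀))) ∧
    -- in natural principal parameters with the same normalization: uniqueness on the whole domain
    (∀ (D₁ : Set (ℝ × ℝ)) (z₁ z₂ : ℝ × ℝ → V3),
      IsOpen D₁ → IsConnected D₁ → (u₀, v₀) ∈ D₁ → D₁ ⊆ D →
      HasInvariants f g S ν u₀ a z₁ D₁ → HasInvariants f g S ν u₀ a z₂ D₁ →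
      IsNatural f g (fun p => ν p.1) (ν u₀) z₁ D₁ →
      IsNatural f g (fun p => ν p.1) (ν u₀) z₂ D₁ →
      coefG z₁ (u₀, v₀) = coefG z₂ (u₀, v₀) →
      ∃ T : V3 → V3, IsMotion T ∧ ∀ p ∈ D₁, z₁ p = T (z₂ p)) := by
  have hUo : IsOpen (Prod.fst '' D) := isOpenMap_fst D hD
  have hU : IsAdmissible f g S ν u₀ (Prod.fst '' D) :=
    ⟨hfg, hUo, hν, by rintro _ ⟨p, hp, rfl⟩; exact hνS p hp,
      by rintro _ ⟨p, hp, rfl⟩; exact hνu p hp, ⟨_, h₀, rfl⟩⟩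
  have hsub : ∀ {D' : Set (ℝ × ℝ)}, D' ⊆ D → ∀ p ∈ D', p.1 ∈ Prod.fst '' D :=
    fun hD' p hp => ⟨p, hD' hp, rfl⟩
  refine ⟨?_, fun D₁ D₂ z₁ z₂ o₁ o₂ m₁ m₂ s₁ s₂ h₁ h₂ =>
    h₁.unique_up_to_parameter h₂ o₁ o₂ ha hU (hsub s₁) (hsub s₂) m₁ m₂,
    fun D₁ z₁ z₂ o₁ c₁ m₁ s₁ h₁ h₂ n₁ n₂ hG =>
      h₁.unique_of_natural h₂ o₁ c₁ ha hU (hsub s₁) m₁ n₁ n₂ hG⟩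
  obtain ⟨r, hr, hrD⟩ := Metric.isOpen_iff.1 hD _ h₀
  have hmem : (u₀, v₀) ∈ Metric.ball (u₀, v₀) r := Metric.mem_ball_self hr
  have hball : Metric.ball (u₀, v₀) r ⊆ Metric.ball u₀ r ×ˢ univ := by
    rw [← ball_prod_same]
    exact prod_mono_right (subset_univ _)
  -- All hypotheses concern u only, so the segment v = v₀ of the square suffices to place the
  -- u-interval in the projection of D.
  have hline : ∀ u ∈ Metric.ball u₀ r, (u, v₀) ∈ D := fun u hu => hrD (by
    rw [← ball_prod_same]
    exact ⟨hu, Metric.mem_ball_self hr⟩)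
  refine ⟨Metric.ball (u₀, v₀) r, Metric.isOpen_ball, (convex_ball _ r).isConnected ⟨_, hmem⟩,
    hmem, hrD, fun b hb => ?_⟩
  obtain ⟨z, hz, hn, hG⟩ := exists_surface ha
    (hU.mono Metric.isOpen_ball (fun u hu => ⟨_, hline u hu, rfl⟩) (Metric.mem_ball_self hr))
    (ordConnected_real_ball u₀ r) (fun u hu => hode _ (hline u hu)) hb
  exact ⟨z, hz.mono hball, hn.mono hball, hG v₀⟩
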